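/- For a complex polynomial $P$ of degree $n\ge 1$ let $[\![P]\!]=\frac1n\sum_{z:P(z)=0}\delta_z$ (zeros counted with multiplicity) be its empirical distribution of zeros, and for $s\in\mathbb C$ let $\exp\{-\frac s2\partial_z^2\}P=\sum_{j\ge 0}\frac1{j!}\left(-\frac s2\right)^j\partial_z^{2j}P$. For $z\in\mathbb C$ put $$\Psi(z)=\tfrac14\operatorname{Re}\left(z^2-z\sqrt{z^2-4}\right)+\log\left|\frac{z+\sqrt{z^2-4}}2\right|-\frac12,$$ where $\sqrt{z^2-4}$ is holomorphic on $\mathbb C\setminus[-2,2]$ with $\sqrt{z^2-4}\sim z$ as $|z|\to\infty$ (on $[-2,2]$ the sign of the root does not affect $\Psi$; also $\Psi(-z)=\Psi(z)$). For $t>0$ let $\mathsf{sc}_t$ be the Wigner semicircle law, i.e. the probability measure on $[-2\sqrt t,2\sqrt t]\subset\mathbb C$ with density $\frac{\sqrt{4t-x^2}}{2\pi t}$ with respect to Lebesgue measure on this interval. Fix $r>0$. For every $t\in\mathbb C\setminus\{0\}$ there is exactly one locally finite Borel measure $\mu_{r,t}$ on $\mathbb C$ with $$\mu_{r,t}=\frac1{2\pi}\Delta\max\left\{\Psi\left(\frac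 z{\sqrt t}\right),\log\frac r{\sqrt{|t|}}\right\}$$ in the sense of distributions ($\Delta$ is the distributional Laplacian on $\mathbb C=\mathbb R^2$). It is a probability measure, and, as $n\to\infty$, the probability measures $[\![\exp\{-\frac t{2n}\partial_z^2\}(z^n-r^n)]\!]$ converge weakly to $\mu_{r,t}$. Moreover: (a) If $0<t\le r^2/\mathrm e$, then the support of $\mu_{r,t}$ is contained in the level set $L_{r,t}:=\{z\in\mathbb C:\Psi(z/\sqrt t)=\log(r/\sqrt t)\}$. (b) If $r^2/\mathrm e<t<r^2\mathrm e$, then $\sqrt{2t\log(r^2\mathrm e/t)}<2\sqrt t$, and the support of $\mu_{r,t}$ is contained in the union of $L_{r,t}$ and the non-empty real intervals $\left[\sqrt{2t\log(r^2\mathrm e/t)},2\sqrt t\right]$ and $\left[-2\sqrt t,-\sqrt{2t\log(r^2\mathrm e/t)}\right]$. (c) If $t\ge r^2\mathrm e$, then $\mu_{r,t}=\mathsf{sc}_t$. (d) If $t=|t|\mathrm e^{\mathrm i\phi}\ne 0$ with $\phi\in\mathbb R$, then $\mu_{r,t}$ is the push-forward of $\mu_{r,|t|}$ under the rotation $z\mapsto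 z\mathrm e^{\mathrm i\phi/2}$. -/

import Mathlib

open Filter Topology MeasureTheory Set
open scoped NNReal ENNReal ContDiff

noncomputable section

namespace HeatFlowZeros

/-- The heat-flow operator `exp(-(s/2) ∂²) P = ∑_j (1/j!) (-s/2)^j ∂^{2j} P` on polynomials.
All terms with `2 j > deg P` vanish, so the series terminates. -/
def heatFlow (s : ℂ) (P : Polynomial ℂ) : Polynomial ℂ :=
  ∑ j ∈ Finset.range (P.natDegree + 1),
    ((1 / (j.factorial : ℂ)) * (-s / 2) ^ j) • (Polynomial.derivative^[2 * j] P)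

/-- The empirical distribution of the complex zeros of `P`: each zero, counted with multiplicity,
gets the mass `1 / deg P`. It is the zero measure if `P` is constant. -/
def zeroDistribution (P : Polynomial ℂ) : FiniteMeasure ℂ :=
  ((P.natDegree : ℝ≥0)⁻¹) • (P.roots.map fun z => (diracProba z).toFiniteMeasure).sum

/-- The heat-evolved polynomial `exp(-(t/(2n)) ∂²) (z^n - r^n)`. -/
def evolvedPoly (r : ℝ) (t : ℂ) (n : ℕ) : Polynomial ℂ :=
  heatFlow (t / (n : ℂ)) (Polynomial.X ^ n - Polynomial.C ((r : ℂ) ^ n))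

/-- The branch of `√(z² - 4)` that is holomorphic on `ℂ \ [-2, 2]` and asymptotic to `z` at
infinity, as the product of the principal branches of `√(z - 2)` and `√(z + 2)`. -/
def sqrtSqSubFour (z : ℂ) : ℂ :=
  (z - 2) ^ (1 / 2 : ℂ) * (z + 2) ^ (1 / 2 : ℂ)

/-- `Ψ(z) = (1/4) Re (z² - z √(z² - 4)) + log |(z + √(z² - 4)) / 2| - 1/2`. -/
def Psi (z : ℂ) : ℝ :=
  (1 / 4) * (z ^ 2 - z * sqrtSqSubFour z).re + Real.log ‖(z + sqrtSqSubFour z) / 2‖ - 1 / 2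

/-- The function `z ↦ max {Ψ(z / √t), log (r / √|t|)}`. Since `Ψ` is even, the choice of the square
root of `t` is immaterial; the principal one is used. -/
def potential (r : ℝ) (t : ℂ) (z : ℂ) : ℝ :=
  max (Psi (z / t ^ (1 / 2 : ℂ))) (Real.log (r / √‖t‖))

/-- `IsRieszMeasure u m` says that `m = (1 / 2π) Δ u` in the sense of distributions on `ℂ`:
`u` is locally integrable, `m` is a locally finite Borel measure, and
`∫ φ dm = (1 / 2π) ∫ u Δφ` for all test functions `φ`, with `ℂ = ℝ²` and Lebesgue measure. -/
structure IsRieszMeasure (u : ℂ → ℝ) (m : Measure ℂ) : Prop where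
  locallyIntegrable : LocallyIntegrable u volume
  locallyFinite : IsLocallyFiniteMeasure m
  integral_eq : ∀ φ : ℂ → ℝ, ContDiff ℝ ∞ φ → HasCompactSupport φ →
    ∫ z, φ z ∂m = (1 / (2 * Real.pi)) * ∫ z, u z * Laplacian.laplacian φ z

/-- The level set `{z | Ψ(z / √t) = log (r / √t)}`, for real `t > 0`. -/
def levelSet (r t : ℝ) : Set ℂ :=
  {z | Psi (z / ((√t : ℝ) : ℂ)) = Real.log (r / √t)}

/-- The closed real interval `[a, b]` as a subset of `ℂ`. -/
def realSegment (a b : ℝ) : Set ℂ :=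
  (fun x : ℝ => (x : ℂ)) '' Icc a b

/-- The Wigner semicircle law of variance `t > 0`, as a measure on `ℂ`: it lives on the interval
`[-2√t, 2√t]` of the real line with the density `√(4t - x²) / (2πt)`. -/
def semicircle (t : ℝ) : Measure ℂ :=
  ((volume.restrict (Icc (-2 * √t) (2 * √t))).withDensity
    (fun x : ℝ => ENNReal.ofReal (√(4 * t - x ^ 2) / (2 * Real.pi * t)))).map
      (fun x : ℝ => (x : ℂ))

end HeatFlowZeros

end

namespace HeatFlowZeros

/-! ### The inverse Joukowski map and the function `Psi` -/

/-! The heat flow fixes constants, so the evolved polynomial is a rescaled Hermite polynomial of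
degree `n` minus `r ^ n`. Both terms grow exponentially in `n`. With `a ^ 2 = t`, the Hermite term
has rate `log √|t| + Psi (z / a)` and the constant has rate `log r`. Where the rates differ, the
larger one wins, so `(1/n) log |P_n|` converges almost everywhere to `log √|t| + potential r t`.
Since `log |·|` is `2π` times a fundamental solution, the Laplacian of `(1/n) log |P_n|` is `2π`
times the zero distribution. Passing to the limit against test functions identifies the limit
measure.

Hermite growth: let `w = outerRoot z` be the solution of `w + 1/w = z` with `|w| ≥ 1`. Then `Psi =
(1/2) Re w⁻² + log |w|`, locally the real part of a primitive of `1/w` up to a constant. The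
normalised logarithmic derivative `F` of the Hermite polynomial satisfies a Riccati equation whose
right side factors as `-N (F - w)(F - 1/w)`. Cauchy's estimate bounds `F'`, and the signs of
imaginary parts keep `F` away from `w`, so `F` is within `O(1/N)` of `1/w`
(`norm_logDeriv_scaledHermite_sub_le`). Integrating down a vertical line from infinity compares the
potentials (`abs_log_scaledHermite_sub_Psi_le`).

The limit: almost everywhere convergence is upgraded to convergence of integrals by a uniform local
`L²` bound, available because all zeros lie in a fixed disc (`norm_le_of_isRoot_evolvedPoly`,
`tendsto_integral_mul_of_sq_bound`). Smooth test functions determine a locally finite measure, so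
the Riesz measure is unique. Compactness then yields both its existence and weak convergence
(`exists_limit_zeroDistribution`).

Supports: `Psi (z / √t)` is, up to a constant, the logarithmic potential of the semicircle law
(`integral_log_semicircle`). Hence the limit has no mass where the constant dominates strictly, and
where `Psi` dominates strictly it can charge only `[-2√t, 2√t]`. There `Psi (x / √t) = x² / (4t) -
1/2`, which gives the three regimes in `t`. Rotation covariance comes from `Psi` being even and from
rotation invariance of the Laplacian. -/

/-- The outer inverse `(z + √(z² - 4)) / 2` of the Joukowski map `w ↦ w + 1 / w`. -/
noncomputable def outerRoot (z : ℂ) : ℂ := (z + sqrtSqSubFour z) / 2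

lemma cpow_half_sq (z : ℂ) : (z ^ (1 / 2 : ℂ)) ^ 2 = z := by
  rw [one_div]
  exact_mod_cast Complex.cpow_nat_inv_pow z (n := 2) two_ne_zero

lemma cpow_half_ne_zero {z : ℂ} (hz : z ≠ 0) : z ^ (1 / 2 : ℂ) ≠ 0 := by
  intro h
  have := cpow_half_sq z
  rw [h] at this
  exact hz (by simpa using this.symm)

lemma norm_cpow_half (z : ℂ) : ‖z ^ (1 / 2 : ℂ)‖ = √‖z‖ := by
  rw [eq_comm, Real.sqrt_eq_iff_mul_self_eq (norm_nonneg _) (norm_nonneg _), ← sq, ← norm_pow,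
    cpow_half_sq]

lemma ofReal_cpow_half {t : ℝ} (ht : 0 ≤ t) : (t : ℂ) ^ (1 / 2 : ℂ) = (√t : ℝ) := by
  rw [Real.sqrt_eq_rpow, Complex.ofReal_cpow ht]
  norm_num

lemma sqrtSqSubFour_sq (z : ℂ) : sqrtSqSubFour z ^ 2 = z ^ 2 - 4 := by
  rw [sqrtSqSubFour, mul_pow, cpow_half_sq, cpow_half_sq]
  ring

lemma outerRoot_eq (z : ℂ) : outerRoot z ^ 2 - z * outerRoot z + 1 = 0 := by
  have := sqrtSqSubFour_sq z
  rw [outerRoot]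
  linear_combination this / 4

lemma outerRoot_ne_zero (z : ℂ) : outerRoot z ≠ 0 := by
  intro h
  have := outerRoot_eq z
  simp [h] at this

lemma inv_outerRoot (z : ℂ) : (outerRoot z)⁻¹ = (z - sqrtSqSubFour z) / 2 := by
  apply inv_eq_of_mul_eq_one_right
  have := sqrtSqSubFour_sq z
  rw [outerRoot]
  linear_combination -this / 4

lemma outerRoot_add_inv (z : ℂ) : outerRoot z + (outerRoot z)⁻¹ = z := by
  rw [inv_outerRoot, outerRoot]
  ring

/-- If `a`, `b` are the principal roots of `z - 2`, `z + 2`, then `w = ((a + b) / 2)²` and `1/w =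
((a - b) / 2)²`. Both `a` and `b` lie in one closed quadrant, so `|a - b| ≤ |a + b|`. This shows
that the product of principal branches selects the outer root, on the cut as well. -/
lemma one_le_norm_outerRoot (z : ℂ) : 1 ≤ ‖outerRoot z‖ := by
  set a := (z - 2) ^ (1 / 2 : ℂ) with ha
  set b := (z + 2) ^ (1 / 2 : ℂ) with hb
  have ha2 : a ^ 2 = z - 2 := cpow_half_sq _
  have hb2 : b ^ 2 = z + 2 := cpow_half_sq _
  have hw : outerRoot z = ((a + b) / 2) ^ 2 := by
    rw [outerRoot, sqrtSqSubFour]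
    linear_combination -(ha2 + hb2) / 4
  have hw' : (outerRoot z)⁻¹ = ((a - b) / 2) ^ 2 := by
    rw [inv_outerRoot, sqrtSqSubFour]
    linear_combination -(ha2 + hb2) / 4
  have hre : 0 ≤ a.re * b.re := by
    rw [ha, hb, one_div, Complex.cpow_inv_two_re, Complex.cpow_inv_two_re]
    positivity
  -- `z - 2` and `z + 2` have the same imaginary part, so their principal roots lie on the same side
  -- of the real axis.
  have him : 0 ≤ a.im * b.im := by
    rw [ha, hb, one_div]
    rcases le_or_gt 0 z.im with h | h
    · rw [Complex.cpow_inv_two_im_eq_sqrt (by simpa using h),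
        Complex.cpow_inv_two_im_eq_sqrt (by simpa using h)]
      positivity
    · rw [Complex.cpow_inv_two_im_eq_neg_sqrt (by simpa using h),
        Complex.cpow_inv_two_im_eq_neg_sqrt (by simpa using h), neg_mul_neg]
      positivity
  have h1 : ‖(outerRoot z)⁻¹‖ ≤ ‖outerRoot z‖ := by
    rw [hw', hw, norm_pow, norm_pow]
    gcongr 1
    rw [norm_div, norm_div]
    gcongr 1
    rw [← sq_le_sq₀ (norm_nonneg _) (norm_nonneg _), ← Complex.normSq_eq_norm_sq,
      ← Complex.normSq_eq_norm_sq, Complex.normSq_apply, Complex.normSq_apply]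
    simp only [Complex.sub_re, Complex.sub_im, Complex.add_re, Complex.add_im]
    nlinarith
  rw [norm_inv] at h1
  have h0 : 0 < ‖outerRoot z‖ := norm_pos_iff.2 (outerRoot_ne_zero z)
  rw [inv_le_iff_one_le_mul₀ h0] at h1
  nlinarith

/-- The squared modulus of `outerRoot z`, see `normSq_outerRoot`. -/
noncomputable def outerRadiusSq (z : ℂ) : ℝ :=
  ((‖z‖ ^ 2 + ‖z ^ 2 - 4‖) / 2 + √(((‖z‖ ^ 2 + ‖z ^ 2 - 4‖) / 2) ^ 2 - 4)) / 2

lemma continuous_outerRadiusSq : Continuous outerRadiusSq := by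
  unfold outerRadiusSq
  fun_prop

/-- The root `w` itself may jump across `[-2, 2]`, but its modulus does not. By the parallelogram
law for `z = w + 1/w` and `√(z² - 4) = w - 1/w`, the number `m = |w|²` solves `m + 1/m = (|z|² + |z²
- 4|) / 2`, and `m ≥ 1` picks the larger solution. -/
lemma norm_outerRoot_sq (z : ℂ) : ‖outerRoot z‖ ^ 2 = outerRadiusSq z := by
  have h1 := one_le_norm_outerRoot z
  set m := ‖outerRoot z‖ ^ 2 with hm
  have hm1 : 1 ≤ m := one_le_pow₀ h1
  have hB : (‖z‖ ^ 2 + ‖z ^ 2 - 4‖) / 2 = m + m⁻¹ := by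
    have h2 : m⁻¹ = ‖(outerRoot z)⁻¹‖ ^ 2 := by rw [norm_inv, hm, inv_pow]
    have h3 := parallelogram_law_with_norm ℝ z (sqrtSqSubFour z)
    rw [h2, hm, inv_outerRoot, outerRoot, norm_div, norm_div, ← sqrtSqSubFour_sq, norm_pow,
      Complex.norm_ofNat]
    nlinarith
  rw [outerRadiusSq, hB]
  have h4 : (m + m⁻¹) ^ 2 - 4 = (m - m⁻¹) ^ 2 := by
    field_simp
    ring
  have h5 : m⁻¹ ≤ 1 := inv_le_one_of_one_le₀ hm1
  rw [h4, Real.sqrt_sq (by linarith)]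
  ring

lemma one_le_outerRadiusSq (z : ℂ) : 1 ≤ outerRadiusSq z := by
  rw [← norm_outerRoot_sq]
  exact one_le_pow₀ (one_le_norm_outerRoot z)

lemma Psi_eq_outerRoot (z : ℂ) :
    Psi z = (1 / 2) * (((outerRoot z)⁻¹) ^ 2).re + Real.log ‖outerRoot z‖ := by
  have h : z ^ 2 - z * sqrtSqSubFour z = 2 + 2 * ((outerRoot z)⁻¹) ^ 2 := by
    have := sqrtSqSubFour_sq z
    rw [inv_outerRoot]
    linear_combination -this / 2
  have h' : (z ^ 2 - z * sqrtSqSubFour z).re = 2 + 2 * (((outerRoot z)⁻¹) ^ 2).re := by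
    rw [h]
    simp
  rw [Psi, h', ← outerRoot]
  ring

/-- Since `z² - 2 = w² + w⁻²` and `Re w⁻² = Re w² / |w|⁴`, the root `w` enters only through its
modulus. Continuity of `Psi` across the cut and its symmetries can be read off from this form. -/
lemma Psi_eq (z : ℂ) :
    Psi z = (z ^ 2 - 2).re / (2 * (1 + outerRadiusSq z ^ 2)) +
      (1 / 2) * Real.log (outerRadiusSq z) := by
  rw [Psi_eq_outerRoot, ← norm_outerRoot_sq, Real.log_pow]
  have h1 := one_le_norm_outerRoot z
  have h : z ^ 2 - 2 = outerRoot z ^ 2 + ((outerRoot z)⁻¹) ^ 2 := by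
    conv_lhs => rw [← outerRoot_add_inv z]
    field_simp [outerRoot_ne_zero z]
    ring
  have h2 : (((outerRoot z)⁻¹) ^ 2).re = (outerRoot z ^ 2).re / (‖outerRoot z‖ ^ 2) ^ 2 := by
    rw [inv_pow, Complex.inv_re, Complex.normSq_eq_norm_sq, norm_pow]
  rw [h, Complex.add_re, h2]
  have : 0 < ‖outerRoot z‖ := by linarith
  push_cast
  field_simp
  ring

lemma continuous_Psi : Continuous Psi := by
  have : Psi = fun z => (z ^ 2 - 2).re / (2 * (1 + outerRadiusSq z ^ 2)) +
      (1 / 2) * Real.log (outerRadiusSq z) := funext Psi_eq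
  rw [this]
  have h := continuous_outerRadiusSq
  refine Continuous.add (Continuous.div (by fun_prop) (by fun_prop) fun z => by positivity)
    (continuous_const.mul (h.log fun z => ?_))
  linarith [one_le_outerRadiusSq z]

lemma Psi_neg (z : ℂ) : Psi (-z) = Psi z := by
  have : outerRadiusSq (-z) = outerRadiusSq z := by simp [outerRadiusSq]
  rw [Psi_eq, Psi_eq, this, neg_sq]

lemma Psi_conj (z : ℂ) : Psi (starRingEnd ℂ z) = Psi z := by
  have h : starRingEnd ℂ z ^ 2 - 4 = starRingEnd ℂ (z ^ 2 - 4) := by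
    simp only [map_sub, map_pow]
    congr 1
    exact (Complex.conj_ofReal 4).symm
  have : outerRadiusSq (starRingEnd ℂ z) = outerRadiusSq z := by
    simp only [outerRadiusSq, h, RCLike.norm_conj]
  rw [Psi_eq, Psi_eq, this]
  congr 2
  simp [sq]

lemma Psi_ofReal {x : ℝ} (hx : |x| ≤ 2) : Psi x = x ^ 2 / 4 - 1 / 2 := by
  have hx2 : x ^ 2 ≤ 4 := by nlinarith [abs_nonneg x, sq_abs x]
  have h : ‖((x : ℂ) ^ 2 - 4)‖ = 4 - x ^ 2 := by
    have : ((x : ℂ) ^ 2 - 4) = ((x ^ 2 - 4 : ℝ) : ℂ) := by push_cast; ring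
    rw [this, Complex.norm_real, Real.norm_eq_abs, abs_of_nonpos (by linarith)]
    ring
  have : outerRadiusSq x = 1 := by
    rw [outerRadiusSq, h, Complex.norm_real, Real.norm_eq_abs, sq_abs,
      show (x ^ 2 + (4 - x ^ 2)) / 2 = 2 by ring]
    norm_num
  rw [Psi_eq, this]
  have : ((x : ℂ) ^ 2 - 2).re = x ^ 2 - 2 := by
    simp [sq]
  rw [this]
  norm_num
  ring

/-- Taking imaginary parts in `w + 1/w = z` gives `Im z = (1 - |w|⁻²) Im w`, and the factor is
nonnegative. -/
lemma outerRoot_im_pos {z : ℂ} (hz : 0 < z.im) : 0 < (outerRoot z).im := by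
  have h := congrArg Complex.im (outerRoot_add_inv z)
  rw [Complex.add_im, Complex.inv_im] at h
  by_contra! hn
  have h1 : 1 ≤ Complex.normSq (outerRoot z) := by
    rw [Complex.normSq_eq_norm_sq]
    exact one_le_pow₀ (one_le_norm_outerRoot z)
  have h2 : -(outerRoot z).im / Complex.normSq (outerRoot z) ≤ -(outerRoot z).im :=
    div_le_self (by linarith) h1
  linarith

lemma im_le_outerRoot_im {z : ℂ} (hz : 0 < z.im) : z.im ≤ (outerRoot z).im := by
  have h := congrArg Complex.im (outerRoot_add_inv z)
  rw [Complex.add_im, Complex.inv_im] at h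
  have h1 := outerRoot_im_pos hz
  have h2 : 0 ≤ (outerRoot z).im / Complex.normSq (outerRoot z) :=
    div_nonneg h1.le (Complex.normSq_nonneg _)
  rw [neg_div] at h
  linarith

lemma one_lt_norm_outerRoot {z : ℂ} (hz : z.im ≠ 0) : 1 < ‖outerRoot z‖ := by
  refine lt_of_le_of_ne (one_le_norm_outerRoot z) fun h => hz ?_
  have h1 := congrArg Complex.im (outerRoot_add_inv z)
  rw [Complex.add_im, Complex.inv_im, Complex.normSq_eq_norm_sq, ← h] at h1
  simpa using h1.symm

lemma hasDerivAt_cpow_half {z : ℂ} (hz : z ∈ Complex.slitPlane) :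
    HasDerivAt (fun z : ℂ => z ^ (1 / 2 : ℂ)) (1 / (2 * z ^ (1 / 2 : ℂ))) z := by
  have h0 := cpow_half_ne_zero (Complex.slitPlane_ne_zero hz)
  refine ((hasDerivAt_id z).cpow_const (c := 1 / 2) hz).congr_deriv ?_
  simp only [id]
  rw [Complex.cpow_sub _ _ (Complex.slitPlane_ne_zero hz), Complex.cpow_one]
  have := cpow_half_sq z
  have hz0 := Complex.slitPlane_ne_zero hz
  field_simp
  exact this

lemma hasDerivAt_sqrtSqSubFour {z : ℂ} (hz : z.im ≠ 0) :
    HasDerivAt sqrtSqSubFour (z / sqrtSqSubFour z) z := by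
  have ha : z - 2 ∈ Complex.slitPlane := Or.inr (by simpa using hz)
  have hb : z + 2 ∈ Complex.slitPlane := Or.inr (by simpa using hz)
  have h1 := (hasDerivAt_cpow_half ha).comp z ((hasDerivAt_id z).sub_const 2)
  have h2 := (hasDerivAt_cpow_half hb).comp z ((hasDerivAt_id z).add_const 2)
  refine (h1.mul h2).congr_deriv ?_
  have ha0 := cpow_half_ne_zero (Complex.slitPlane_ne_zero ha)
  have hb0 := cpow_half_ne_zero (Complex.slitPlane_ne_zero hb)
  simp only [sqrtSqSubFour, Function.comp, id]
  have ha2 := cpow_half_sq (z - 2)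
  have hb2 := cpow_half_sq (z + 2)
  set a := (z - 2) ^ (1 / 2 : ℂ)
  set b := (z + 2) ^ (1 / 2 : ℂ)
  field_simp
  linear_combination (ha2 + hb2)

/-- The vertical derivative of `Psi` in the upper half plane. -/
lemma hasDerivAt_Psi_vertical {x y : ℝ} (hy : 0 < y) :
    HasDerivAt (fun y : ℝ => Psi (x + y * Complex.I))
      (-((outerRoot (x + y * Complex.I))⁻¹).im) y := by
  set z : ℂ := x + y * Complex.I with hz
  have hzim : z.im = y := by simp [hz]
  have hS := hasDerivAt_sqrtSqSubFour (z := z) (by rw [hzim]; exact hy.ne')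
  have hw0 := outerRoot_ne_zero z
  have hwim : 0 < (outerRoot z).im := outerRoot_im_pos (by rw [hzim]; exact hy)
  have hS0 : sqrtSqSubFour z ≠ 0 := by
    intro h
    have h1 := sqrtSqSubFour_sq z
    have h2 : outerRoot z = (outerRoot z)⁻¹ := by rw [inv_outerRoot, outerRoot, h]; ring
    have h3 : ‖outerRoot z‖ = ‖outerRoot z‖⁻¹ := by rw [← norm_inv, ← h2]
    have h4 := one_lt_norm_outerRoot (z := z) (by rw [hzim]; exact hy.ne')
    have h5 := inv_lt_one_of_one_lt₀ h4
    linarith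
  -- `Psi + 1/2` is the real part of this holomorphic primitive of `1/w`. The principal logarithm is
  -- legitimate because `w` stays in the upper half plane. In the direction `I` the derivative
  -- becomes `Re (I / w) = -Im (1/w)`.
  have hG : HasDerivAt (fun z => 1 / 4 * (z ^ 2 - z * sqrtSqSubFour z) +
      Complex.log (outerRoot z)) (outerRoot z)⁻¹ z := by
    have h1 := (((hasDerivAt_id z).pow 2).sub ((hasDerivAt_id z).mul hS)).const_mul (1 / 4)
    have h2 := (((hasDerivAt_id z).add hS).div_const 2).clog (Or.inr hwim.ne')
    refine (h1.add h2).congr_deriv ?_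
    have h3 := sqrtSqSubFour_sq z
    have h4 : (id z + sqrtSqSubFour z) ≠ 0 := by
      intro h
      exact hw0 (by rw [outerRoot]; simp only [id] at h; rw [h]; simp)
    simp only [id] at h4
    rw [inv_outerRoot]
    simp only [Pi.add_apply, id]
    field_simp
    linear_combination (2 * (z + sqrtSqSubFour z)) * h3
  have hl : HasDerivAt (fun y : ℝ => (x : ℂ) + y * Complex.I) Complex.I y := by
    simpa using ((Complex.ofRealCLM.hasDerivAt (x := y)).mul_const Complex.I).const_add (x : ℂ)
  have h5 := (hG.comp y hl)
  have h6 := (Complex.reCLM.hasFDerivAt.comp_hasDerivAt y h5).sub_const (1 / 2)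
  refine (h6.congr_deriv ?_).congr_of_eventuallyEq (Eventually.of_forall fun y => ?_)
  · simp
  · beta_reduce
    simp only [Psi, Function.comp, Complex.reCLM_apply, Complex.add_re, Complex.log_re]
    rw [← outerRoot]
    congr 2
    rw [show (1 / 4 : ℂ) = ((1 / 4 : ℝ) : ℂ) by norm_num, Complex.re_ofReal_mul]

lemma strictMonoOn_Psi_vertical (x : ℝ) :
    StrictMonoOn (fun y : ℝ => Psi (x + y * Complex.I)) (Ici 0) := by
  refine strictMonoOn_of_deriv_pos (convex_Ici 0) ?_ fun y hy => ?_
  · exact (continuous_Psi.comp (by fun_prop)).continuousOn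
  · rw [interior_Ici, mem_Ioi] at hy
    rw [(hasDerivAt_Psi_vertical hy).deriv]
    have := outerRoot_im_pos (z := x + y * Complex.I) (by simpa using hy)
    rw [Complex.inv_im, neg_div, neg_neg]
    exact div_pos this (Complex.normSq_pos.2 (outerRoot_ne_zero _))

lemma neg_half_le_Psi (z : ℂ) : -(1 / 2) ≤ Psi z := by
  have h1 := one_le_norm_outerRoot z
  have h2 : ‖((outerRoot z)⁻¹) ^ 2‖ ≤ 1 := by
    rw [norm_pow, norm_inv]
    exact pow_le_one₀ (by positivity) (inv_le_one_of_one_le₀ h1)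
  have h3 := (abs_le.1 ((Complex.abs_re_le_norm (((outerRoot z)⁻¹) ^ 2)).trans h2)).1
  have h4 := Real.log_nonneg h1
  rw [Psi_eq_outerRoot]
  linarith

/-- By Fubini it suffices that each vertical line meets the level set in at most two points: one in
the closed upper half by strict monotonicity, one in the lower half by conjugation symmetry. Level
sets are where the two growth rates tie, and they must be negligible. -/
lemma volume_Psi_eq (c : ℝ) : volume {z | Psi z = c} = 0 := by
  have hmeas : MeasurableSet {z | Psi z = c} :=
    (isClosed_singleton.preimage continuous_Psi).measurableSet
  rw [← (Complex.volume_preserving_equiv_real_prod.symm).measure_preimage hmeas.nullMeasurableSet,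
    Measure.volume_eq_prod, Measure.measure_prod_null
      (Complex.volume_preserving_equiv_real_prod.symm.measurable hmeas)]
  refine Eventually.of_forall fun x => ?_
  have hpre : (Prod.mk x ⁻¹' ((Complex.measurableEquivRealProd.symm) ⁻¹' {z | Psi z = c})) =
      {y : ℝ | Psi (x + y * Complex.I) = c} := by
    ext y
    simp only [mem_preimage, mem_ofPred_eq]
    rw [show Complex.measurableEquivRealProd.symm (x, y) = x + y * Complex.I by
      apply Complex.ext <;> simp [Complex.measurableEquivRealProd]]
  have h1 : ({y : ℝ | Psi (x + y * Complex.I) = c} ∩ Ici 0).Subsingleton := by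
    intro a ha b hb
    exact (strictMonoOn_Psi_vertical x).injOn ha.2 hb.2 (ha.1.trans hb.1.symm)
  have h2 : ({y : ℝ | Psi (x + y * Complex.I) = c} ∩ Iic 0).Subsingleton := by
    intro a ha b hb
    have key : ∀ y : ℝ, Psi (x + (-y : ℝ) * Complex.I) = Psi (x + y * Complex.I) := by
      intro y
      rw [← Psi_conj]
      simp
    have := (strictMonoOn_Psi_vertical x).injOn (x₁ := -a) (x₂ := -b)
      (by simpa using! ha.2) (by simpa using! hb.2)
      (by rw [key, key]; exact ha.1.trans hb.1.symm)
    linarith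
  have h3 : {y : ℝ | Psi (x + y * Complex.I) = c} =
      ({y : ℝ | Psi (x + y * Complex.I) = c} ∩ Ici 0) ∪
        ({y : ℝ | Psi (x + y * Complex.I) = c} ∩ Iic 0) := by
    rw [← inter_union_distrib_left, Ici_union_Iic, inter_univ]
  have h4 : volume {y : ℝ | Psi (x + y * Complex.I) = c} = 0 := by
    rw [h3]
    exact (h1.finite.union h2.finite).measure_zero _
  exact (congrArg volume hpre).trans h4

/-! ### Heat flow of polynomials and rescaled Hermite polynomials -/

open Polynomial in
lemma heatFlow_eq_sum (s : ℂ) {P : ℂ[X]} {M : ℕ} (hM : P.natDegree < M) :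
    heatFlow s P = ∑ j ∈ Finset.range M,
      ((1 / (j.factorial : ℂ)) * (-s / 2) ^ j) • (derivative^[2 * j] P) := by
  rw [heatFlow]
  refine Finset.sum_subset (fun j hj => ?_) fun j _ hj => ?_
  · rw [Finset.mem_range] at hj ⊢
    omega
  · rw [Finset.mem_range] at hj
    rw [iterate_derivative_eq_zero (by omega), smul_zero]

-- Every term with `j ≥ 1` differentiates the constant away. This reduces the evolution of `z^n -
-- r^n` to that of `z^n`.
open Polynomial in
lemma heatFlow_sub_C (s : ℂ) (P : ℂ[X]) (a : ℂ) :
    heatFlow s (P - C a) = heatFlow s P - C a := by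
  rw [heatFlow_eq_sum s (M := P.natDegree + 1) (by rw [natDegree_sub_C]; omega), heatFlow,
    Finset.sum_range_succ', Finset.sum_range_succ' _ P.natDegree]
  have : ∀ j : ℕ, derivative^[2 * (j + 1)] (P - C a) = derivative^[2 * (j + 1)] P := by
    intro j
    rw [iterate_derivative_sub, iterate_derivative_C (by omega), sub_zero]
  simp only [this]
  simp
  ring

open Polynomial in
lemma derivative_heatFlow (s : ℂ) (P : ℂ[X]) :
    derivative (heatFlow s P) = heatFlow s (derivative P) := by
  have h := natDegree_derivative_le P
  rw [heatFlow, heatFlow_eq_sum s (M := P.natDegree + 1) (by omega), derivative_sum]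
  refine Finset.sum_congr rfl fun j _ => ?_
  rw [derivative_smul, ← Function.iterate_succ_apply' (f := ⇑derivative),
    Function.iterate_succ_apply]

open Polynomial in
lemma heatFlow_smul (s c : ℂ) (P : ℂ[X]) : heatFlow s (c • P) = c • heatFlow s P := by
  have h := natDegree_smul_le c P
  rw [heatFlow_eq_sum s (M := P.natDegree + 1) (by omega), heatFlow, Finset.smul_sum]
  refine Finset.sum_congr rfl fun j _ => ?_
  rw [iterate_derivative_smul, smul_comm]

-- This is the commutation relation of `exp(-(s/2) ∂²)` with multiplication by `X`. It comes from
-- the Leibniz rule `∂^(2j) (P X) = (∂^(2j) P) X + 2j ∂^(2j-1) P`, and it produces the Hermite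
-- recurrence.
open Polynomial in
lemma heatFlow_mul_X (s : ℂ) (P : ℂ[X]) :
    heatFlow s (P * X) = heatFlow s P * X - s • derivative (heatFlow s P) := by
  have h := natDegree_derivative_le P
  have h2 : (P * X).natDegree ≤ P.natDegree + 1 := by
    simpa using natDegree_mul_le (p := P) (q := X)
  rw [derivative_heatFlow, heatFlow_eq_sum s (P := P * X) (M := P.natDegree + 2) (by omega),
    heatFlow_eq_sum s (P := P) (M := P.natDegree + 2) (by omega),
    heatFlow_eq_sum s (P := derivative P) (M := P.natDegree + 1) (by omega)]
  simp only [iterate_derivative_mul_X, smul_add, Finset.sum_add_distrib, Finset.sum_mul,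
    smul_mul_assoc]
  rw [sub_eq_add_neg]
  congr 1
  -- The `j = 0` correction vanishes. After the shift, `2 (j+1) / (j+1)! · (-s/2)^(j+1) = -s
  -- (-s/2)^j / j!`. The spare term in the two sums of length `natDegree + 2` makes the ranges match
  -- here.
  rw [Finset.sum_range_succ', Finset.smul_sum, ← Finset.sum_neg_distrib]
  simp only [mul_zero, zero_smul, smul_zero, add_zero]
  refine Finset.sum_congr rfl fun j _ => ?_
  rw [show 2 * (j + 1) - 1 = 2 * j + 1 by omega, Function.iterate_succ_apply,
    ← Nat.cast_smul_eq_nsmul ℂ, smul_smul, smul_smul, ← neg_smul]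
  congr 1
  rw [Nat.factorial_succ]
  push_cast
  have h1 : (j.factorial : ℂ) ≠ 0 := by exact_mod_cast j.factorial_ne_zero
  have h3 : ((j : ℂ) + 1) ≠ 0 := by exact_mod_cast j.succ_ne_zero
  field_simp
  ring

/-- The rescaled Hermite polynomial `exp(-(s/2) ∂²) X^k`. -/
noncomputable def scaledHermite (s : ℂ) (k : ℕ) : Polynomial ℂ := heatFlow s (Polynomial.X ^ k)

open Polynomial in
lemma scaledHermite_zero (s : ℂ) : scaledHermite s 0 = 1 := by
  simp [scaledHermite, heatFlow]

open Polynomial in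
lemma derivative_scaledHermite (s : ℂ) (k : ℕ) :
    derivative (scaledHermite s (k + 1)) = ((k : ℂ) + 1) • scaledHermite s k := by
  rw [scaledHermite, derivative_heatFlow, scaledHermite, ← heatFlow_smul, derivative_X_pow]
  simp [smul_eq_C_mul]

open Polynomial in
lemma scaledHermite_succ (s : ℂ) (k : ℕ) :
    scaledHermite s (k + 1) = scaledHermite s k * X - s • derivative (scaledHermite s k) := by
  rw [scaledHermite, pow_succ, heatFlow_mul_X, scaledHermite]

lemma eval_scaledHermite_succ (s : ℂ) (k : ℕ) (z : ℂ) :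
    (scaledHermite s (k + 1)).eval z =
      z * (scaledHermite s k).eval z - s * (scaledHermite s k).derivative.eval z := by
  rw [scaledHermite_succ]
  simp [mul_comm]

lemma eval_scaledHermite_one (s z : ℂ) : (scaledHermite s 1).eval z = z := by
  rw [eval_scaledHermite_succ, scaledHermite_zero]
  simp

lemma eval_scaledHermite_add_two (s : ℂ) (k : ℕ) (z : ℂ) :
    (scaledHermite s (k + 2)).eval z =
      z * (scaledHermite s (k + 1)).eval z - s * (k + 1) * (scaledHermite s k).eval z := by
  rw [eval_scaledHermite_succ, derivative_scaledHermite]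
  simp
  ring

open Polynomial in
lemma scaledHermite_monic_natDegree (s : ℂ) (k : ℕ) :
    (scaledHermite s k).Monic ∧ (scaledHermite s k).natDegree = k := by
  induction k with
  | zero => simp [scaledHermite_zero]
  | succ k ih =>
    have h1 : (scaledHermite s k * X).Monic := ih.1.mul monic_X
    have h2 : (scaledHermite s k * X).natDegree = k + 1 := by
      rw [ih.1.natDegree_mul monic_X, ih.2, natDegree_X]
    have h3 : (s • derivative (scaledHermite s k)).degree < (scaledHermite s k * X).degree := by
      rw [degree_eq_natDegree h1.ne_zero, h2]
      refine lt_of_le_of_lt degree_le_natDegree ?_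
      have := natDegree_smul_le s (derivative (scaledHermite s k))
      have := natDegree_derivative_le (scaledHermite s k)
      exact_mod_cast (by omega :
        (s • derivative (scaledHermite s k)).natDegree < k + 1)
    rw [scaledHermite_succ]
    refine ⟨h1.sub_of_left h3, ?_⟩
    rw [natDegree_eq_of_degree_eq (degree_sub_eq_left_of_degree_lt h3), h2]

lemma eval_scaledHermite_scale (s a : ℂ) (z : ℂ) (k : ℕ) :
    (scaledHermite (a ^ 2 * s) k).eval (a * z) = a ^ k * (scaledHermite s k).eval z := by
  induction k using Nat.twoStepInduction with
  | zero => simp [scaledHermite_zero]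
  | one => simp [eval_scaledHermite_one]
  | more k h1 h2 =>
    rw [eval_scaledHermite_add_two, eval_scaledHermite_add_two, h1, h2]
    ring

lemma eval_scaledHermite_neg (s z : ℂ) (k : ℕ) :
    (scaledHermite s k).eval (-z) = (-1) ^ k * (scaledHermite s k).eval z := by
  simpa using eval_scaledHermite_scale s (-1) z k

/-- Away from the disc of radius `2`, the ratios of consecutive rescaled Hermite polynomials are
bounded below. -/
lemma half_norm_mul_le_scaledHermite {n : ℕ} {z : ℂ} (hz : 2 ≤ ‖z‖) {k : ℕ} (hk : k < n) :
    ‖z‖ / 2 * ‖(scaledHermite (1 / n) k).eval z‖ ≤ ‖(scaledHermite (1 / n) (k + 1)).eval z‖ := by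
  induction k with
  | zero =>
    rw [eval_scaledHermite_one, scaledHermite_zero]
    simp
  | succ k ih =>
    have ih := ih (by omega)
    rw [eval_scaledHermite_add_two]
    set a := (scaledHermite (1 / n) (k + 1)).eval z
    set b := (scaledHermite (1 / n) k).eval z
    have hn : (0 : ℝ) < n := by exact_mod_cast (by omega : 0 < n)
    have hc : ‖(1 / (n : ℂ) * (k + 1))‖ ≤ 1 := by
      have : (1 / (n : ℂ) * (k + 1)) = ((1 / (n : ℝ) * (k + 1) : ℝ) : ℂ) := by push_cast; ring
      rw [this, Complex.norm_real, Real.norm_eq_abs, abs_of_nonneg (by positivity)]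
      rw [one_div_mul_eq_div, div_le_one hn]
      exact_mod_cast (by omega : k + 1 ≤ n)
    have h1 : ‖z * a‖ - ‖(1 / (n : ℂ) * (k + 1)) * b‖ ≤ ‖z * a - 1 / n * (k + 1) * b‖ :=
      norm_sub_norm_le _ _
    have h2 : ‖(1 / (n : ℂ) * (k + 1)) * b‖ ≤ ‖b‖ := by
      rw [norm_mul]
      exact mul_le_of_le_one_left (norm_nonneg _) hc
    rw [norm_mul] at h1
    -- The inductive ratio is at least `|z| / 2 ≥ 1`. With recurrence coefficient at most `1`, the
    -- next ratio is then at least `|z| - 1 ≥ |z| / 2`.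
    have h3 : ‖b‖ ≤ ‖a‖ := by nlinarith [norm_nonneg b]
    nlinarith [norm_nonneg a]

lemma half_norm_pow_le_scaledHermite (n : ℕ) {z : ℂ} (hz : 2 ≤ ‖z‖) :
    (‖z‖ / 2) ^ n ≤ ‖(scaledHermite (1 / n) n).eval z‖ := by
  have : ∀ k ≤ n, (‖z‖ / 2) ^ k ≤ ‖(scaledHermite (1 / n) k).eval z‖ := by
    intro k
    induction k with
    | zero => simp [scaledHermite_zero]
    | succ k ih =>
      intro hk
      refine le_trans ?_ (half_norm_mul_le_scaledHermite hz (by omega))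
      rw [pow_succ']
      gcongr
      exact ih (by omega)
  exact this n le_rfl

/-! ### Growth rate of the Hermite polynomials off the real axis -/

/-- In the upper half plane, the rescaled Hermite polynomials do not vanish, and their ratios are
bounded away from the real axis. -/
lemma scaledHermite_ratio_im {s : ℝ} (hs : 0 ≤ s) {z : ℂ} (hz : 0 < z.im) (k : ℕ) :
    (scaledHermite s k).eval z ≠ 0 ∧
      z.im ≤ ((scaledHermite s (k + 1)).eval z / (scaledHermite s k).eval z).im := by
  induction k with
  | zero => simp [scaledHermite_zero, eval_scaledHermite_one]
  | succ k ih =>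
    rw [eval_scaledHermite_add_two]
    set a := (scaledHermite s (k + 1)).eval z
    set b := (scaledHermite s k).eval z
    obtain ⟨hb, hR⟩ := ih
    have ha : a ≠ 0 := by
      intro h
      rw [h] at hR
      simp at hR
      linarith
    refine ⟨ha, ?_⟩
    -- The ratios satisfy `R' = z - s (k+1) / R`. Inversion sends the upper half plane to the lower
    -- one, so the subtracted term can only raise the imaginary part.
    have h1 : (z * a - s * (k + 1) * b) / a = z - ((s * (k + 1) : ℝ) : ℂ) * (a / b)⁻¹ := by
      push_cast
      field_simp
    rw [h1, Complex.sub_im, Complex.im_ofReal_mul,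
      Complex.inv_im]
    have h2 : -(a / b).im / Complex.normSq (a / b) ≤ 0 :=
      div_nonpos_of_nonpos_of_nonneg (by linarith) (Complex.normSq_nonneg _)
    have h3 : 0 ≤ s * ((k : ℝ) + 1) := by positivity
    nlinarith [mul_nonneg h3 (neg_nonneg.2 h2)]

lemma tendsto_scaledHermite_div_pow (s : ℂ) (k : ℕ) :
    Tendsto (fun z => (scaledHermite s k).eval z / z ^ k) (Bornology.cobounded ℂ) (𝓝 1) := by
  have hne : ∀ᶠ z : ℂ in Bornology.cobounded ℂ, z ≠ 0 := by
    filter_upwards [Bornology.eventually_ne_cobounded (0 : ℂ)] with z hz using hz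
  induction k using Nat.twoStepInduction with
  | zero => simp [scaledHermite_zero]
  | one =>
    refine tendsto_const_nhds.congr' ?_
    filter_upwards [hne] with z hz
    rw [eval_scaledHermite_one, pow_one, div_self hz]
  | more k h1 h2 =>
    have h0 : Tendsto (fun z : ℂ => z⁻¹) (Bornology.cobounded ℂ) (𝓝 0) := tendsto_inv₀_cobounded
    have h3 := h2.sub (((h0.pow 2).const_mul (s * (k + 1))).mul h1)
    simp only [ne_eq, OfNat.ofNat_ne_zero, not_false_eq_true, zero_pow, mul_zero, zero_mul,
      sub_zero] at h3
    refine h3.congr' ?_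
    filter_upwards [hne] with z hz
    rw [eval_scaledHermite_add_two]
    field_simp
    ring


/-- A quantitative form of the convergence of the logarithmic derivatives: it follows from the
Riccati equation of `H' / (n H)` and Cauchy's estimate. -/
lemma norm_logDeriv_scaledHermite_sub_le {n : ℕ} {z : ℂ} (hz : 0 < z.im) :
    ‖(scaledHermite (1 / ((n + 1 : ℕ) : ℂ)) n).eval z /
      (scaledHermite (1 / ((n + 1 : ℕ) : ℂ)) (n + 1)).eval z - (outerRoot z)⁻¹‖ ≤
      4 / ((n + 1 : ℕ) * z.im ^ 3) := by
  have hN : (0 : ℝ) < (n + 1 : ℕ) := by positivity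
  set N : ℕ := n + 1 with hNdef
  set p := scaledHermite (1 / (N : ℂ)) n with hp
  set q := scaledHermite (1 / (N : ℂ)) N with hq
  have hreal : (1 / (N : ℂ)) = ((1 / (N : ℝ) : ℝ) : ℂ) := by push_cast; rfl
  have hratio : ∀ u : ℂ, 0 < u.im → p.eval u ≠ 0 ∧ u.im ≤ (q.eval u / p.eval u).im := by
    intro u hu
    rw [hp, hq, hreal]
    exact scaledHermite_ratio_im (by positivity) hu n
  have hq0 : ∀ u : ℂ, 0 < u.im → q.eval u ≠ 0 := by
    intro u hu h
    have := (hratio u hu).2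
    rw [h] at this
    simp at this
    linarith
  set F : ℂ → ℂ := fun u => p.eval u / q.eval u with hF
  have hFnorm : ∀ u : ℂ, 0 < u.im → ‖F u‖ ≤ 1 / u.im := by
    intro u hu
    have h1 := (hratio u hu).2.trans ((le_abs_self _).trans (Complex.abs_im_le_norm _))
    rw [hF]
    beta_reduce
    rw [← inv_div, norm_inv, one_div]
    exact inv_anti₀ hu h1
  have hFim : (F z).im ≤ 0 := by
    rw [hF]
    beta_reduce
    rw [← inv_div, Complex.inv_im]
    exact div_nonpos_of_nonpos_of_nonneg (by linarith [(hratio z hz).2]) (Complex.normSq_nonneg _)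
  -- The Riccati equation: the Appell property gives `q' = N p`, and the raising relation `q = u p -
  -- p' / N` expresses `p'` through `p` and `q`.
  have hd : ∀ u : ℂ, 0 < u.im → HasDerivAt F (N * (u * F u - 1 - F u ^ 2)) u := by
    intro u hu
    have h1 := (p.hasDerivAt u).div (q.hasDerivAt u) (hq0 u hu)
    refine h1.congr_deriv ?_
    have h2 : q.eval u = u * p.eval u - 1 / N * p.derivative.eval u :=
      eval_scaledHermite_succ _ _ _
    have h3 : q.derivative.eval u = N * p.eval u := by
      rw [hq, hNdef, derivative_scaledHermite]
      simp [hp, hNdef]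
    have hN0 : (N : ℂ) ≠ 0 := by exact_mod_cast hN.ne'
    have h4 : p.derivative.eval u = N * (u * p.eval u - q.eval u) := by
      rw [h2]
      field_simp
      ring
    have h5 := hq0 u hu
    rw [h3, h4, hF]
    beta_reduce
    field_simp
  have hball : ∀ u ∈ Metric.closedBall z (z.im / 2), z.im / 2 ≤ u.im := by
    intro u hu
    rw [mem_closedBall_iff_norm] at hu
    have := (abs_le.1 ((Complex.abs_im_le_norm (u - z)).trans hu)).1
    rw [Complex.sub_im] at this
    linarith
  -- Cauchy's estimate on the disc of radius `Im z / 2`, where `|F| ≤ 1 / Im u ≤ 2 / Im z`.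
  have hC : ‖deriv F z‖ ≤ (2 / z.im) / (z.im / 2) := by
    refine Complex.norm_deriv_le_of_forall_mem_sphere_norm_le (by linarith) ?_ fun u hu => ?_
    · refine DifferentiableOn.diffContOnCl_ball (U := Metric.closedBall z (z.im / 2))
        (fun u hu => ?_) subset_rfl
      have := hball u hu
      exact (hd u (by linarith)).differentiableAt.differentiableWithinAt
    · have h1 := hball u (Metric.sphere_subset_closedBall hu)
      refine (hFnorm u (by linarith)).trans ?_
      rw [one_div_le (by linarith) (by positivity), one_div_div]
      exact h1
  rw [(hd z hz).deriv] at hC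
  have hw0 := outerRoot_ne_zero z
  have hfac : z * F z - 1 - F z ^ 2 = -((F z - outerRoot z) * (F z - (outerRoot z)⁻¹)) := by
    have h1 := outerRoot_add_inv z
    have h2 := mul_inv_cancel₀ hw0
    linear_combination (-F z) * h1 + h2
  rw [hfac, norm_mul, norm_neg, norm_mul, Complex.norm_natCast] at hC
  -- `F z` lies in the closed lower half plane while `Im w ≥ Im z`. So the smallness of the product
  -- forces `F z` to be close to `1/w`, not to `w`.
  have hlow : z.im ≤ ‖F z - outerRoot z‖ := by
    have h1 := (neg_le_abs _).trans (Complex.abs_im_le_norm (F z - outerRoot z))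
    rw [Complex.sub_im] at h1
    linarith [im_le_outerRoot_im hz]
  change ‖F z - (outerRoot z)⁻¹‖ ≤ _
  have h6 : (N : ℝ) * (z.im * ‖F z - (outerRoot z)⁻¹‖) ≤ 2 / z.im / (z.im / 2) :=
    le_trans (by gcongr) hC
  rw [le_div_iff₀ (by positivity)]
  rw [le_div_iff₀ (by positivity), le_div_iff₀ hz] at h6
  nlinarith

lemma hasDerivAt_log_norm {f : ℝ → ℂ} {f' : ℂ} {y : ℝ} (hf : HasDerivAt f f' y) (h0 : f y ≠ 0) :
    HasDerivAt (fun y => Real.log ‖f y‖) (f' / f y).re y := by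
  have h1 : HasDerivAt (fun y => ‖f y‖ ^ 2) (2 * inner ℝ (f y) f') y := hf.norm_sq
  have h2 := (h1.log (by positivity)).const_mul (1 / 2)
  refine (h2.congr_deriv ?_).congr_of_eventuallyEq (Eventually.of_forall fun y => ?_)
  · rw [Complex.inner, Complex.div_re, ← Complex.normSq_eq_norm_sq]
    simp
    ring
  · simp

lemma tendsto_vertical_cobounded (x : ℝ) :
    Tendsto (fun y : ℝ => (x : ℂ) + y * Complex.I) atTop (Bornology.cobounded ℂ) := by
  rw [← tendsto_norm_atTop_iff_cobounded]
  refine tendsto_atTop_mono (fun y => ?_) tendsto_id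
  have := (le_abs_self _).trans (Complex.abs_im_le_norm ((x : ℂ) + y * Complex.I))
  simpa using this

/-- The integration constant for the vertical comparison: both functions are asymptotic to `log
|z|`. The polynomial is monic of degree `n + 1`. For `Psi`, use `z / w = 1 + w⁻²` and `w → ∞`. -/
lemma tendsto_log_scaledHermite_sub_Psi_atTop (x : ℝ) (n : ℕ) :
    Tendsto (fun y : ℝ => (1 / ((n + 1 : ℕ) : ℝ)) *
      Real.log ‖(scaledHermite (1 / ((n + 1 : ℕ) : ℂ)) (n + 1)).eval (x + y * Complex.I)‖ -
        Psi (x + y * Complex.I)) atTop (𝓝 0) := by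
  have hv := tendsto_vertical_cobounded x
  have hH := (tendsto_scaledHermite_div_pow (1 / ((n + 1 : ℕ) : ℂ)) (n + 1)).comp hv
  have hw : Tendsto (fun y : ℝ => (outerRoot (x + y * Complex.I))⁻¹) atTop (𝓝 0) := by
    refine tendsto_inv₀_cobounded.comp (tendsto_norm_atTop_iff_cobounded.1 ?_)
    refine tendsto_atTop_mono' _ ?_ tendsto_id
    filter_upwards [eventually_gt_atTop 0] with y hy
    have h1 := im_le_outerRoot_im (z := (x : ℂ) + y * Complex.I) (by simpa using hy)
    have h2 := (le_abs_self _).trans (Complex.abs_im_le_norm (outerRoot (x + y * Complex.I)))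
    simp at h1 h2 ⊢
    linarith
  have h1 : Tendsto (fun y : ℝ => (1 / ((n + 1 : ℕ) : ℝ)) *
      Real.log ‖(scaledHermite (1 / ((n + 1 : ℕ) : ℂ)) (n + 1)).eval (x + y * Complex.I) /
        (x + y * Complex.I) ^ (n + 1)‖) atTop (𝓝 0) := by
    have := (hH.norm.log (by simp)).const_mul (1 / ((n + 1 : ℕ) : ℝ))
    simpa using this
  have h2 : Tendsto (fun y : ℝ => Real.log ‖1 + ((outerRoot (x + y * Complex.I))⁻¹) ^ 2‖)
      atTop (𝓝 0) := by
    have := ((hw.pow 2).const_add 1).norm.log (by simp)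
    simpa using this
  have h3 : Tendsto (fun y : ℝ => (1 / 2) * (((outerRoot (x + y * Complex.I))⁻¹) ^ 2).re)
      atTop (𝓝 0) := by
    have := ((Complex.continuous_re.tendsto _).comp (hw.pow 2)).const_mul (1 / 2)
    simpa using this
  have h4 := (h1.add h2).sub h3
  rw [add_zero, sub_zero] at h4
  refine h4.congr' ?_
  filter_upwards [eventually_gt_atTop 0] with y hy
  set z : ℂ := x + y * Complex.I with hz
  have hzim : 0 < z.im := by simpa [hz] using hy
  have hz0 : z ≠ 0 := by
    intro h
    rw [h] at hzim
    simp at hzim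
  have hw0 := outerRoot_ne_zero z
  have h5 : 1 + ((outerRoot z)⁻¹) ^ 2 = z / outerRoot z := by
    nth_rewrite 2 [← outerRoot_add_inv z]
    field_simp
  have hreal : (1 / ((n + 1 : ℕ) : ℂ)) = ((1 / ((n + 1 : ℕ) : ℝ) : ℝ) : ℂ) := by
    push_cast
    rfl
  have hHne : (scaledHermite (1 / ((n + 1 : ℕ) : ℂ)) (n + 1)).eval z ≠ 0 := by
    rw [hreal]
    exact (scaledHermite_ratio_im (by positivity) hzim (n + 1)).1
  rw [Psi_eq_outerRoot, h5, norm_div, norm_div, Real.log_div (norm_ne_zero_iff.2 hHne) (norm_ne_zero_iff.2 (pow_ne_zero _ hz0)),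
    Real.log_div (norm_ne_zero_iff.2 hz0) (norm_ne_zero_iff.2 hw0), norm_pow, Real.log_pow]
  have hN : ((n + 1 : ℕ) : ℝ) ≠ 0 := by positivity
  field_simp
  ring

/-- The difference `D` tends to `0` at infinity and `|D'| ≤ 4 / (N u³)`. Integrating the bound from
`y` to infinity gives `2 / (N y²)`. In place of an integral, `D ∓ 2 / (N y²)` is shown to be
monotone with limit `0`. -/
lemma abs_log_scaledHermite_sub_Psi_le {n : ℕ} {x y : ℝ} (hy : 0 < y) :
    |(1 / ((n + 1 : ℕ) : ℝ)) *
      Real.log ‖(scaledHermite (1 / ((n + 1 : ℕ) : ℂ)) (n + 1)).eval (x + y * Complex.I)‖ -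
        Psi (x + y * Complex.I)| ≤ 2 / ((n + 1 : ℕ) * y ^ 2) := by
  set N : ℝ := ((n + 1 : ℕ) : ℝ) with hN
  have hNpos : 0 < N := by positivity
  set D : ℝ → ℝ := fun y => (1 / N) *
    Real.log ‖(scaledHermite (1 / ((n + 1 : ℕ) : ℂ)) (n + 1)).eval (x + y * Complex.I)‖ -
      Psi (x + y * Complex.I) with hD
  have hlim : Tendsto D atTop (𝓝 0) := tendsto_log_scaledHermite_sub_Psi_atTop x n
  have hB : Tendsto (fun y : ℝ => 2 / (N * y ^ 2)) atTop (𝓝 0) :=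
    tendsto_const_nhds.div_atTop ((tendsto_pow_atTop (by norm_num)).const_mul_atTop hNpos)
  have hBd : ∀ u : ℝ, 0 < u → HasDerivAt (fun y : ℝ => 2 / (N * y ^ 2)) (-(4 / (N * u ^ 3))) u := by
    intro u hu
    have h1 := (((hasDerivAt_id u).pow 2).const_mul N).inv (by simpa using ⟨hNpos.ne', hu.ne'⟩)
    have h2 := h1.const_mul 2
    refine (h2.congr_deriv ?_).congr_of_eventuallyEq (Eventually.of_forall fun y => ?_)
    · simp
      field_simp
      ring
    · simp [div_eq_mul_inv]
  have hDd : ∀ u : ℝ, 0 < u → ∃ d, HasDerivAt D d u ∧ |d| ≤ 4 / (N * u ^ 3) := by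
    intro u hu
    set z : ℂ := x + u * Complex.I with hz
    have hzim : z.im = u := by simp [hz]
    have hl : HasDerivAt (fun y : ℝ => (x : ℂ) + y * Complex.I) Complex.I u := by
      simpa using ((Complex.ofRealCLM.hasDerivAt (x := u)).mul_const Complex.I).const_add (x : ℂ)
    have hreal : (1 / ((n + 1 : ℕ) : ℂ)) = ((1 / ((n + 1 : ℕ) : ℝ) : ℝ) : ℂ) := by
      push_cast
      rfl
    have hHne : (scaledHermite (1 / ((n + 1 : ℕ) : ℂ)) (n + 1)).eval z ≠ 0 := by
      rw [hreal]
      exact (scaledHermite_ratio_im (by positivity) (by rw [hzim]; exact hu) (n + 1)).1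
    have h1 := ((scaledHermite (1 / ((n + 1 : ℕ) : ℂ)) (n + 1)).hasDerivAt z).comp u hl
    have h2 := ((hasDerivAt_log_norm h1 hHne).const_mul (1 / N)).sub (hasDerivAt_Psi_vertical (x := x) hu)
    refine ⟨_, h2, ?_⟩
    have h3 := norm_logDeriv_scaledHermite_sub_le (n := n) (z := z) (by rw [hzim]; exact hu)
    rw [hzim] at h3
    refine le_trans (le_of_eq ?_) ((Complex.abs_im_le_norm _).trans h3)
    rw [derivative_scaledHermite, ← abs_neg, Complex.sub_im]
    congr 1
    rw [← hz]
    have h4 : (((n : ℂ) + 1) • scaledHermite (1 / ((n + 1 : ℕ) : ℂ)) n).eval z * Complex.I /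
        ((fun x => (scaledHermite (1 / ((n + 1 : ℕ) : ℂ)) (n + 1)).eval x) ∘
          fun y : ℝ => (x : ℂ) + y * Complex.I) u =
        (N : ℝ) * (((scaledHermite (1 / ((n + 1 : ℕ) : ℂ)) n).eval z /
      (scaledHermite (1 / ((n + 1 : ℕ) : ℂ)) (n + 1)).eval z) * Complex.I) := by
      simp only [Function.comp, Polynomial.eval_smul, smul_eq_mul]
      rw [← hz, hN]
      push_cast
      ring
    rw [h4, Complex.re_ofReal_mul, Complex.mul_I_re]
    field_simp
    ring
  have hup : D y ≤ 2 / (N * y ^ 2) := by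
    have hmono : MonotoneOn (fun y => D y - 2 / (N * y ^ 2)) (Ioi 0) := by
      refine monotoneOn_of_deriv_nonneg (convex_Ioi 0) ?_ ?_ ?_
      · intro u hu
        obtain ⟨d, hd, -⟩ := hDd u hu
        exact (hd.sub (hBd u hu)).continuousAt.continuousWithinAt
      · intro u hu
        rw [interior_Ioi] at hu
        obtain ⟨d, hd, -⟩ := hDd u hu
        exact (hd.sub (hBd u hu)).differentiableAt.differentiableWithinAt
      · intro u hu
        rw [interior_Ioi] at hu
        obtain ⟨d, hd, hd'⟩ := hDd u hu
        have h1 : deriv (fun y => D y - 2 / (N * y ^ 2)) u = _ := (hd.sub (hBd u hu)).deriv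
        rw [h1]
        linarith [(abs_le.1 hd').1]
    have hl := hlim.sub hB
    rw [sub_zero] at hl
    have := ge_of_tendsto hl (b := D y - 2 / (N * y ^ 2))
      (by
        filter_upwards [eventually_ge_atTop y] with u hu
        exact hmono hy (hy.trans_le hu) hu)
    linarith
  have hlow : -(2 / (N * y ^ 2)) ≤ D y := by
    have hanti : AntitoneOn (fun y => D y + 2 / (N * y ^ 2)) (Ioi 0) := by
      refine antitoneOn_of_deriv_nonpos (convex_Ioi 0) ?_ ?_ ?_
      · intro u hu
        obtain ⟨d, hd, -⟩ := hDd u hu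
        exact (hd.add (hBd u hu)).continuousAt.continuousWithinAt
      · intro u hu
        rw [interior_Ioi] at hu
        obtain ⟨d, hd, -⟩ := hDd u hu
        exact (hd.add (hBd u hu)).differentiableAt.differentiableWithinAt
      · intro u hu
        rw [interior_Ioi] at hu
        obtain ⟨d, hd, hd'⟩ := hDd u hu
        have h1 : deriv (fun y => D y + 2 / (N * y ^ 2)) u = _ := (hd.add (hBd u hu)).deriv
        rw [h1]
        linarith [(abs_le.1 hd').2]
    have hl := hlim.add hB
    rw [add_zero] at hl
    have := le_of_tendsto hl (b := D y + 2 / (N * y ^ 2))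
      (by
        filter_upwards [eventually_ge_atTop y] with u hu
        exact hanti hy (hy.trans_le hu) hu)
    linarith
  exact abs_le.2 ⟨hlow, hup⟩

/-- The exponential growth rate of the rescaled Hermite polynomials off the real axis. -/
lemma tendsto_log_scaledHermite {z : ℂ} (hz : z.im ≠ 0) :
    (∀ n : ℕ, (scaledHermite (1 / (n : ℂ)) n).eval z ≠ 0) ∧
    Tendsto (fun n : ℕ => (1 / (n : ℝ)) * Real.log ‖(scaledHermite (1 / (n : ℂ)) n).eval z‖)
      atTop (𝓝 (Psi z)) := by
  -- Parity of the Hermite polynomials and evenness of `Psi` transfer the result to the lower half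
  -- plane.
  wlog hpos : 0 < z.im generalizing z with H
  · have h1 := H (z := -z) (by simpa using hz)
      (by simpa using lt_of_le_of_ne (not_lt.1 hpos) hz)
    simp only [eval_scaledHermite_neg, norm_mul, norm_pow, norm_neg, norm_one, one_pow, one_mul,
      Psi_neg] at h1
    refine ⟨fun n h => h1.1 n (by rw [h, mul_zero]), h1.2⟩
  refine ⟨fun n => ?_, ?_⟩
  · have hreal : (1 / (n : ℂ)) = ((1 / (n : ℝ) : ℝ) : ℂ) := by push_cast; rfl
    rw [hreal]
    exact (scaledHermite_ratio_im (by positivity) hpos n).1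
  · rw [← tendsto_add_atTop_iff_nat 1, tendsto_iff_norm_sub_tendsto_zero]
    have hb : Tendsto (fun n : ℕ => 2 / (((n + 1 : ℕ) : ℝ) * z.im ^ 2)) atTop (𝓝 0) := by
      refine tendsto_const_nhds.div_atTop (Tendsto.atTop_mul_const (by positivity) ?_)
      exact (tendsto_natCast_atTop_atTop).comp (tendsto_add_atTop_nat 1)
    refine squeeze_zero (fun _ => norm_nonneg _) (fun n => ?_) hb
    have := abs_log_scaledHermite_sub_Psi_le (n := n) (x := z.re) hpos
    rw [Complex.re_add_im] at this
    exact this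

/-! ### The logarithm as fundamental solution of the Laplacian in the plane -/

lemma laplacian_eq_fderiv_fderiv (φ : ℂ → ℝ) (z : ℂ) :
    Laplacian.laplacian φ z = fderiv ℝ (fderiv ℝ φ) z 1 1 +
      fderiv ℝ (fderiv ℝ φ) z Complex.I Complex.I := by
  rw [InnerProductSpace.laplacian_eq_iteratedFDeriv_complexPlane]
  simp [iteratedFDeriv_two_apply]

lemma laplacian_comp_add_right (φ : ℂ → ℝ) (a z : ℂ) :
    Laplacian.laplacian (fun z => φ (z + a)) z = Laplacian.laplacian φ (z + a) := by
  rw [InnerProductSpace.laplacian_eq_iteratedFDeriv_complexPlane,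
    InnerProductSpace.laplacian_eq_iteratedFDeriv_complexPlane]
  simp only [iteratedFDeriv_comp_add_right]

lemma continuous_fderiv_fderiv {φ : ℂ → ℝ} (hφ : ContDiff ℝ ∞ φ) :
    Continuous (fderiv ℝ (fderiv ℝ φ)) :=
  (hφ.fderiv_right (m := ∞) (by simp)).continuous_fderiv (by simp)

lemma continuous_laplacian {φ : ℂ → ℝ} (hφ : ContDiff ℝ ∞ φ) :
    Continuous (Laplacian.laplacian φ) := by
  have h := continuous_fderiv_fderiv hφ
  rw [funext (laplacian_eq_fderiv_fderiv φ)]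
  fun_prop

lemma tsupport_laplacian_subset (φ : ℂ → ℝ) :
    tsupport (Laplacian.laplacian φ) ⊆ tsupport φ := by
  refine closure_minimal (fun z hz => ?_) (isClosed_tsupport φ)
  rw [Function.mem_support] at hz
  by_contra h
  have h1 : fderiv ℝ (fderiv ℝ φ) z = 0 := by
    by_contra h2
    exact h (tsupport_fderiv_subset ℝ (support_fderiv_subset ℝ h2))
  rw [laplacian_eq_fderiv_fderiv, h1] at hz
  simp at hz

lemma hasCompactSupport_laplacian {φ : ℂ → ℝ} (hφ : HasCompactSupport φ) :
    HasCompactSupport (Laplacian.laplacian φ) :=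
  hφ.of_isClosed_subset (isClosed_tsupport _) (tsupport_laplacian_subset φ)

/-- The unit vector with argument `θ`. -/
noncomputable def unitVec (θ : ℝ) : ℂ := Real.cos θ + Real.sin θ * Complex.I

lemma hasDerivAt_unitVec (θ : ℝ) : HasDerivAt unitVec (Complex.I * unitVec θ) θ := by
  have h1 := (Real.hasDerivAt_cos θ).ofReal_comp
  have h2 := (Real.hasDerivAt_sin θ).ofReal_comp
  refine (h1.add (h2.mul_const Complex.I)).congr_deriv ?_
  rw [unitVec]
  push_cast
  linear_combination (-Complex.sin θ) * Complex.I_sq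

lemma continuous_unitVec : Continuous unitVec :=
  continuous_iff_continuousAt.2 fun θ => (hasDerivAt_unitVec θ).continuousAt

lemma norm_unitVec (θ : ℝ) : ‖unitVec θ‖ = 1 := by
  rw [unitVec, Complex.ofReal_cos, Complex.ofReal_sin, ← Complex.exp_mul_I,
    Complex.norm_exp_ofReal_mul_I]

/-- The trace of the Hessian is the same in every orthonormal frame. The mixed terms cancel without
appeal to symmetry of the second derivative. -/
lemma laplacian_eq_unitVec (φ : ℂ → ℝ) (z : ℂ) (θ : ℝ) :
    Laplacian.laplacian φ z = fderiv ℝ (fderiv ℝ φ) z (unitVec θ) (unitVec θ) +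
      fderiv ℝ (fderiv ℝ φ) z (Complex.I * unitVec θ) (Complex.I * unitVec θ) := by
  have h1 : unitVec θ = Real.cos θ • (1 : ℂ) + Real.sin θ • Complex.I := by
    simp [unitVec]
  have h2 : Complex.I * unitVec θ = (-Real.sin θ) • (1 : ℂ) + Real.cos θ • Complex.I := by
    simp only [unitVec, Complex.real_smul]
    push_cast
    linear_combination (Complex.sin θ) * Complex.I_sq
  rw [laplacian_eq_fderiv_fderiv, h2, h1]
  simp only [map_add, map_smul, _root_.add_apply, _root_.smul_apply,
    smul_eq_mul]
  have := Real.sin_sq_add_cos_sq θ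
  linear_combination (-(fderiv ℝ (fderiv ℝ φ) z 1 1 +
    fderiv ℝ (fderiv ℝ φ) z Complex.I Complex.I)) * this

lemma integrableOn_log_fst_mul {h : ℝ × ℝ → ℝ} (hh : Continuous h) {R : ℝ}
    (hR : ∀ p : ℝ × ℝ, R < p.1 → h p = 0) :
    IntegrableOn (fun p : ℝ × ℝ => Real.log p.1 * h p)
      (Ioi 0 ×ˢ Ioo (-Real.pi) Real.pi) (volume.prod volume) := by
  have h1 : IntegrableOn Real.log (Icc 0 R) := by
    rcases le_or_gt 0 R with h0 | h0
    · rw [← intervalIntegrable_iff_integrableOn_Icc_of_le h0]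
      exact intervalIntegral.intervalIntegrable_log'
    · simp [Icc_eq_empty (not_le.2 h0)]
  have h2 : IntegrableOn (fun p : ℝ × ℝ => Real.log p.1)
      (Icc 0 R ×ˢ Icc (-Real.pi) Real.pi) (volume.prod volume) := by
    rw [IntegrableOn, ← Measure.prod_restrict]
    have h3 : Integrable (fun _ : ℝ => (1 : ℝ)) (volume.restrict (Icc (-Real.pi) Real.pi)) := by
      simp
    simpa using h1.integrable.mul_prod h3
  have h4 := h2.mul_continuousOn hh.continuousOn (isCompact_Icc.prod isCompact_Icc)
  have h5 : IntegrableOn (fun p : ℝ × ℝ => Real.log p.1 * h p)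
      (Ici 0 ×ˢ Icc (-Real.pi) Real.pi) (volume.prod volume) := by
    refine h4.of_forall_sdiff_eq_zero (measurableSet_Ici.prod measurableSet_Icc) fun p hp => ?_
    rw [hR p, mul_zero]
    by_contra! hle
    exact hp.2 ⟨⟨hp.1.1, hle⟩, hp.1.2⟩
  exact h5.mono_set (prod_mono Ioi_subset_Ici_self Ioo_subset_Icc_self)

lemma integrableOn_log_mul {h : ℝ → ℝ} (hh : Continuous h) {R : ℝ}
    (hR : ∀ x, R < x → h x = 0) : IntegrableOn (fun x => Real.log x * h x) (Ioi 0) := by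
  have h1 : IntegrableOn Real.log (Icc 0 R) := by
    rcases le_or_gt 0 R with h0 | h0
    · rw [← intervalIntegrable_iff_integrableOn_Icc_of_le h0]
      exact intervalIntegral.intervalIntegrable_log'
    · simp [Icc_eq_empty (not_le.2 h0)]
  have h4 := h1.mul_continuousOn hh.continuousOn isCompact_Icc
  have h5 : IntegrableOn (fun x => Real.log x * h x) (Ici 0) := by
    refine h4.of_forall_sdiff_eq_zero measurableSet_Ici fun p hp => ?_
    rw [hR p, mul_zero]
    by_contra! hle
    exact hp.2 ⟨hp.1, hle⟩
  exact h5.mono_set Ioi_subset_Ici_self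

/-- In polar coordinates `ρ Δφ = f₁ + f₂`, where `f₁` is the `ρ`-derivative of `ρ ∂_ρ φ` and `f₂` is
a `θ`-derivative. Only the radial part contributes, giving `φ 0` on each ray. The singularity needs
no excision, because `ρ log ρ` is continuous at `0`. -/
lemma integral_log_norm_mul_laplacian_zero {φ : ℂ → ℝ} (hφ : ContDiff ℝ ∞ φ)
    (hc : HasCompactSupport φ) :
    ∫ z, Real.log ‖z‖ * Laplacian.laplacian φ z = 2 * Real.pi * φ 0 := by
  set D := fderiv ℝ φ with hD
  set D2 := fderiv ℝ (fderiv ℝ φ) with hD2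
  have hDc : Continuous D := hφ.continuous_fderiv (by simp)
  have hD2c : Continuous D2 := continuous_fderiv_fderiv hφ
  have hφd : ∀ z, HasFDerivAt φ (D z) z := fun z =>
    (hφ.differentiable (by simp) z).hasFDerivAt
  have hDd : ∀ z, HasFDerivAt D (D2 z) z := fun z =>
    ((hφ.fderiv_right (m := ∞) (by simp)).differentiable (by simp) z).hasFDerivAt
  obtain ⟨R, hR⟩ : ∃ R : ℝ, tsupport φ ⊆ Metric.closedBall 0 R :=
    hc.isCompact.isBounded.subset_closedBall 0
  have hzφ : ∀ z : ℂ, R < ‖z‖ → φ z = 0 := fun z hz => by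
    by_contra h
    have := hR (subset_tsupport _ h)
    rw [mem_closedBall_zero_iff] at this
    linarith
  have hzD : ∀ z : ℂ, R < ‖z‖ → D z = 0 := fun z hz => by
    by_contra h
    have := hR (support_fderiv_subset ℝ h)
    rw [mem_closedBall_zero_iff] at this
    linarith
  have hzD2 : ∀ z : ℂ, R < ‖z‖ → D2 z = 0 := fun z hz => by
    by_contra h
    have := hR (tsupport_fderiv_subset ℝ (support_fderiv_subset ℝ h))
    rw [mem_closedBall_zero_iff] at this
    linarith
  have hnorm : ∀ ρ θ : ℝ, R < ρ → R < ‖(ρ : ℂ) * unitVec θ‖ := fun ρ θ h => by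
    rw [norm_mul, norm_unitVec, mul_one, Complex.norm_real]
    exact h.trans_le (le_abs_self ρ)
  have hradial : ∀ ρ θ : ℝ, HasDerivAt (fun ρ : ℝ => (ρ : ℂ) * unitVec θ) (unitVec θ) ρ := by
    intro ρ θ
    simpa using (Complex.ofRealCLM.hasDerivAt (x := ρ)).mul_const (unitVec θ)
  have hangular : ∀ ρ θ : ℝ,
      HasDerivAt (fun θ : ℝ => (ρ : ℂ) * unitVec θ) (ρ * (Complex.I * unitVec θ)) θ :=
    fun ρ θ => (hasDerivAt_unitVec θ).const_mul (ρ : ℂ)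
  have he := continuous_unitVec
  -- the radial part
  set f₁ : ℝ × ℝ → ℝ := fun p => D (p.1 * unitVec p.2) (unitVec p.2) +
    p.1 * D2 (p.1 * unitVec p.2) (unitVec p.2) (unitVec p.2) with hf₁
  -- the angular part
  set f₂ : ℝ × ℝ → ℝ := fun p => p.1 * D2 (p.1 * unitVec p.2) (Complex.I * unitVec p.2)
    (Complex.I * unitVec p.2) - D (p.1 * unitVec p.2) (unitVec p.2) with hf₂
  have hf₁c : Continuous f₁ := by fun_prop
  have hf₂c : Continuous f₂ := by fun_prop
  have hf₁z : ∀ p : ℝ × ℝ, R < p.1 → f₁ p = 0 := fun p hp => by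
    simp [hf₁, hzD _ (hnorm _ p.2 hp), hzD2 _ (hnorm _ p.2 hp)]
  have hf₂z : ∀ p : ℝ × ℝ, R < p.1 → f₂ p = 0 := fun p hp => by
    simp [hf₂, hzD _ (hnorm _ p.2 hp), hzD2 _ (hnorm _ p.2 hp)]
  have hi₁ := integrableOn_log_fst_mul hf₁c hf₁z
  have hi₂ := integrableOn_log_fst_mul hf₂c hf₂z
  -- A primitive is `ρ log ρ ∂_ρ φ - φ`. It vanishes at infinity and equals `-φ 0` at the origin.
  have hint₁ : ∀ θ : ℝ, ∫ ρ in Ioi (0 : ℝ), Real.log ρ * f₁ (ρ, θ) = φ 0 := by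
    intro θ
    have h := integral_Ioi_of_hasDerivAt_of_tendsto
      (f := fun ρ => ρ * Real.log ρ * D (ρ * unitVec θ) (unitVec θ) - φ (ρ * unitVec θ))
      (f' := fun ρ => Real.log ρ * f₁ (ρ, θ)) (a := 0) (m := 0) ?_ ?_ ?_ ?_
    · rw [h]
      simp
    · have h1 : Continuous fun ρ : ℝ => ρ * Real.log ρ := Real.continuous_mul_log
      have h2 : Continuous fun ρ : ℝ => D (ρ * unitVec θ) (unitVec θ) := by fun_prop
      have h3 : Continuous fun ρ : ℝ => φ (ρ * unitVec θ) := hφ.continuous.comp (by fun_prop)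
      exact ((h1.mul h2).sub h3).continuousAt.continuousWithinAt
    · intro ρ hρ
      have hρ0 : ρ ≠ 0 := (mem_Ioi.1 hρ).ne'
      have h1 := (hDd (ρ * unitVec θ)).comp_hasDerivAt ρ (hradial ρ θ)
      have h2 := h1.clm_apply (hasDerivAt_const ρ (unitVec θ))
      have h3 := (hφd (ρ * unitVec θ)).comp_hasDerivAt ρ (hradial ρ θ)
      refine (((Real.hasDerivAt_mul_log hρ0).mul h2).sub h3).congr_deriv ?_
      simp only [hf₁, map_zero, add_zero, Function.comp]
      ring
    · exact integrableOn_log_mul (h := fun ρ => f₁ (ρ, θ)) (by fun_prop) (R := R)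
        fun ρ hρ => hf₁z (ρ, θ) hρ
    · refine tendsto_const_nhds.congr' ?_
      filter_upwards [eventually_gt_atTop R] with ρ hρ
      simp [hzD _ (hnorm ρ θ hρ), hzφ _ (hnorm ρ θ hρ)]
  -- `f₂` is the `θ`-derivative of a periodic function, the derivative of `φ` in the direction `I *
  -- unitVec θ`.
  have hint₂ : ∀ ρ : ℝ, ∫ θ in Ioo (-Real.pi) Real.pi, Real.log ρ * f₂ (ρ, θ) = 0 := by
    intro ρ
    rw [integral_const_mul]
    have h := intervalIntegral.integral_eq_sub_of_hasDerivAt (a := -Real.pi) (b := Real.pi)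
      (f := fun θ => D (ρ * unitVec θ) (Complex.I * unitVec θ)) (f' := fun θ => f₂ (ρ, θ))
      (fun θ _ => ?_) (Continuous.intervalIntegrable (by fun_prop) _ _)
    · rw [intervalIntegral.integral_of_le (by linarith [Real.pi_pos]),
        integral_Ioc_eq_integral_Ioo] at h
      rw [h]
      simp [unitVec]
    · have h1 := (hDd (ρ * unitVec θ)).comp_hasDerivAt θ (hangular ρ θ)
      have h2 := h1.clm_apply ((hasDerivAt_unitVec θ).const_mul Complex.I)
      refine h2.congr_deriv ?_
      have h3 : (ρ : ℂ) * (Complex.I * unitVec θ) = ρ • (Complex.I * unitVec θ) := by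
        simp
      have h4 : Complex.I * (Complex.I * unitVec θ) = -unitVec θ := by
        linear_combination (unitVec θ) * Complex.I_sq
      simp only [hf₂]
      rw [h3, h4]
      simp only [map_smul, _root_.smul_apply, smul_eq_mul, map_neg, Function.comp]
      ring
  rw [← Complex.integral_comp_polarCoord_symm, polarCoord_target, Measure.volume_eq_prod]
  have hcongr : ∀ p ∈ Ioi (0 : ℝ) ×ˢ Ioo (-Real.pi) Real.pi,
      p.1 • (Real.log ‖Complex.polarCoord.symm p‖ *
        Laplacian.laplacian φ (Complex.polarCoord.symm p)) =
      Real.log p.1 * f₁ p + Real.log p.1 * f₂ p := by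
    intro p hp
    have hsymm : Complex.polarCoord.symm p = p.1 * unitVec p.2 := Complex.polarCoord_symm_apply p
    rw [hsymm, norm_mul, norm_unitVec, mul_one, Complex.norm_real, Real.norm_eq_abs, Real.log_abs,
      laplacian_eq_unitVec φ _ p.2, smul_eq_mul]
    simp only [hf₁, hf₂]
    ring
  rw [setIntegral_congr_fun (measurableSet_Ioi.prod measurableSet_Ioo) hcongr,
    integral_add hi₁ hi₂, setIntegral_prod _ hi₂]
  have hi₁' := hi₁
  rw [IntegrableOn, ← Measure.prod_restrict] at hi₁'
  rw [← Measure.prod_restrict, integral_prod_symm _ hi₁']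
  simp only [hint₁, hint₂]
  simp
  left
  rw [max_eq_left (by positivity)]
  ring

lemma integral_log_norm_sub_mul_laplacian {φ : ℂ → ℝ} (hφ : ContDiff ℝ ∞ φ)
    (hc : HasCompactSupport φ) (a : ℂ) :
    ∫ z, Real.log ‖z - a‖ * Laplacian.laplacian φ z = 2 * Real.pi * φ a := by
  have h := integral_log_norm_mul_laplacian_zero (φ := fun z => φ (z + a))
    (hφ.comp (contDiff_id.add contDiff_const))
    (hc.comp_homeomorph (Homeomorph.addRight a))
  simp only [laplacian_comp_add_right, zero_add] at h
  rw [← h, ← integral_add_right_eq_self (fun z => Real.log ‖z - a‖ * Laplacian.laplacian φ z) a]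
  simp

/-- In polar coordinates the integrand is `y log² y = 4 (√y log √y)²`, which is continuous up to
`0`. -/
lemma integrable_indicator_sq_log_norm (R : ℝ) :
    IntegrableOn (fun z : ℂ => Real.log ‖z‖ ^ 2) (Metric.ball 0 R) := by
  have h1 : Integrable (fun z : ℂ => (Iio R).indicator (fun x => Real.log x ^ 2) ‖z‖) := by
    rw [integrable_fun_norm_addHaar]
    have h2 : ∀ y ∈ Ioi (0 : ℝ), y ^ (Module.finrank ℝ ℂ - 1) •
        (Iio R).indicator (fun x => Real.log x ^ 2) y =
        (Iio R).indicator (fun x => 4 * (√x * Real.log √x) ^ 2) y := by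
      intro y hy
      have hy0 : (0 : ℝ) ≤ y := (mem_Ioi.1 hy).le
      simp only [indicator, Complex.finrank_real_complex]
      split_ifs
      · rw [Real.log_sqrt hy0, mul_pow, Real.sq_sqrt hy0, smul_eq_mul]
        ring
      · simp
    rw [integrableOn_congr_fun h2 measurableSet_Ioi, IntegrableOn,
      integrable_indicator_iff measurableSet_Iio, IntegrableOn,
      Measure.restrict_restrict measurableSet_Iio]
    have h3 : Continuous fun x => 4 * (√x * Real.log √x) ^ 2 :=
      continuous_const.mul ((Real.continuous_mul_log.comp Real.continuous_sqrt).pow 2)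
    exact (h3.continuousOn.integrableOn_Icc (a := 0) (b := R)).mono_set
      fun x hx => ⟨(mem_Ioi.1 hx.2).le, (mem_Iio.1 hx.1).le⟩
  rw [← integrable_indicator_iff measurableSet_ball]
  refine h1.congr (Eventually.of_forall fun z => ?_)
  simp only [indicator, mem_Iio, mem_ball_zero_iff]

/-! ### The logarithmic potential of the semicircle law -/

lemma one_sub_div_mem_slitPlane {w ζ : ℂ} (hw : 1 < ‖w‖) (hζ : ‖ζ‖ ≤ 1) :
    1 - ζ / w ∈ Complex.slitPlane := by
  refine Complex.mem_slitPlane_of_norm_lt_one (z := -(ζ / w)) ?_ |> fun h => by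
    simpa [sub_eq_add_neg] using h
  rw [norm_neg, norm_div, div_lt_one (by linarith)]
  linarith

lemma hasDerivAt_log_one_sub_div {w ζ : ℂ} (hw : 1 < ‖w‖) (hζ : ‖ζ‖ ≤ 1) :
    HasDerivAt (fun ζ => Complex.log (1 - ζ / w)) (-(w - ζ)⁻¹) ζ := by
  have hm := one_sub_div_mem_slitPlane hw hζ
  refine ((((hasDerivAt_id ζ).div_const w).const_sub 1).clog hm).congr_deriv ?_
  have hw0 : w ≠ 0 := norm_pos_iff.1 (by linarith)
  have h0 := Complex.slitPlane_ne_zero hm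
  have h1 : w - ζ ≠ 0 := by
    intro h
    apply h0
    rw [sub_eq_zero] at h
    rw [← h, div_self hw0, sub_self]
  have h2 : w * (1 - ζ / w) = w - ζ := by field_simp
  simp only [id]
  rw [← h2]
  field_simp

/-- The average extracts Taylor coefficients of `log (1 - ζ / w)`. The terms with `1` and `ζ²`
average to the value `0` at the centre. The term with `ζ⁻²` picks the coefficient `-1 / (2 w²)` of
`ζ²`, by Cauchy's formula for the second derivative. -/
lemma circleAverage_log_one_sub_div {w : ℂ} (hw : 1 < ‖w‖) :
    Real.circleAverage (fun ζ => Complex.log (1 - ζ / w) * (1 - (ζ ^ 2 + (ζ⁻¹) ^ 2) / 2)) 0 1 =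
      1 / (4 * w ^ 2) := by
  have hw0 : w ≠ 0 := norm_pos_iff.1 (by linarith)
  set g : ℂ → ℂ := fun ζ => Complex.log (1 - ζ / w) with hg
  have hgd : DifferentiableOn ℂ g (Metric.closedBall 0 1) := fun ζ hζ =>
    (hasDerivAt_log_one_sub_div hw
      (mem_closedBall_zero_iff.1 hζ)).differentiableAt.differentiableWithinAt
  have hg0 : g 0 = 0 := by simp [hg]
  have h1 : Real.circleAverage (fun ζ => g ζ * (1 - ζ ^ 2 / 2)) 0 1 = 0 := by
    have hd : DifferentiableOn ℂ (fun ζ => g ζ * (1 - ζ ^ 2 / 2)) (Metric.closedBall 0 1) :=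
      hgd.mul (by fun_prop)
    have := (hd.diffContOnCl_ball (c := 0) (R := |1|) (by simp)).circleAverage
    rw [this, hg0, zero_mul]
  have hiter : iteratedDeriv 2 g 0 = -(1 / w ^ 2) := by
    rw [iteratedDeriv_succ, iteratedDeriv_one]
    have heq : deriv g =ᶠ[𝓝 0] fun ζ => -(w - ζ)⁻¹ := by
      filter_upwards [Metric.ball_mem_nhds (0 : ℂ) one_pos] with ζ hζ
      exact (hasDerivAt_log_one_sub_div hw (mem_ball_zero_iff.1 hζ).le).deriv
    rw [heq.deriv_eq]
    have := ((((hasDerivAt_id (0 : ℂ)).const_sub w).inv (by simpa using hw0))).neg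
    rw [HasDerivAt.deriv (f := fun ζ => -(w - ζ)⁻¹) this]
    simp
  have h2 : Real.circleAverage (fun ζ => g ζ * (ζ⁻¹) ^ 2) 0 1 = -(1 / (2 * w ^ 2)) := by
    rw [Real.circleAverage_eq_circleIntegral one_ne_zero]
    have h3 := (hgd.diffContOnCl_ball (R := 1) subset_rfl).circleIntegral_one_div_sub_center_pow_smul
      one_pos 2
    rw [hiter] at h3
    have h4 : (∮ z in C(0, 1), (z - 0)⁻¹ • (g z * (z⁻¹) ^ 2)) =
        ∮ z in C(0, 1), (1 / (z - 0) ^ (2 + 1)) • g z := by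
      congr 1
      ext z
      simp only [sub_zero, smul_eq_mul, one_div, inv_pow]
      ring
    rw [h4, h3]
    have hpi : (Real.pi : ℂ) ≠ 0 := by exact_mod_cast Real.pi_ne_zero
    have hI := Complex.I_ne_zero
    simp only [smul_eq_mul, Nat.factorial_two]
    push_cast
    field_simp
  have hci : ∀ k : ℂ → ℂ, ContinuousOn k (Metric.sphere 0 1) → CircleIntegrable k 0 1 :=
    fun k hk => hk.circleIntegrable zero_le_one
  have hgc : ContinuousOn g (Metric.sphere 0 1) :=
    hgd.continuousOn.mono Metric.sphere_subset_closedBall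
  have hic : ContinuousOn (fun ζ : ℂ => ζ⁻¹) (Metric.sphere 0 1) :=
    continuousOn_inv₀.mono fun ζ hζ h => by simp [mem_singleton_iff.1 h] at hζ
  have hsplit : (fun ζ => g ζ * (1 - (ζ ^ 2 + (ζ⁻¹) ^ 2) / 2)) =
      fun ζ => g ζ * (1 - ζ ^ 2 / 2) - (1 / 2 : ℂ) • (g ζ * (ζ⁻¹) ^ 2) := by
    ext ζ
    simp only [smul_eq_mul]
    ring
  rw [hsplit, Real.circleAverage_fun_sub (hci (fun ζ => g ζ * (1 - ζ ^ 2 / 2)) (hgc.mul (by fun_prop)))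
    (hci (fun ζ => (1 / 2 : ℂ) • (g ζ * (ζ⁻¹) ^ 2)) ((hgc.mul (hic.pow 2)).const_smul (1 / 2 : ℂ))), Real.circleAverage_fun_smul, h1, h2]
  simp only [smul_eq_mul]
  field_simp
  ring

lemma inv_eq_conj_of_mem_sphere {ζ : ℂ} (hζ : ‖ζ‖ = 1) : ζ⁻¹ = starRingEnd ℂ ζ := by
  rw [Complex.inv_def, Complex.normSq_eq_norm_sq, hζ]
  simp

lemma one_sub_div_ne_zero {w ζ : ℂ} (hw : 1 < ‖w‖) (hζ : ‖ζ‖ ≤ 1) : 1 - ζ / w ≠ 0 :=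
  Complex.slitPlane_ne_zero (one_sub_div_mem_slitPlane hw hζ)

lemma circleAverage_log_norm_one_sub_div {w : ℂ} (hw : 1 < ‖w‖) :
    Real.circleAverage (fun ζ => Real.log ‖1 - ζ / w‖ * (1 - (ζ ^ 2).re)) 0 1 =
      (1 / 4) * ((w⁻¹) ^ 2).re := by
  have hw0 : w ≠ 0 := norm_pos_iff.1 (by linarith)
  have h := circleAverage_log_one_sub_div hw
  have hc : ContinuousOn (fun ζ => Complex.log (1 - ζ / w) * (1 - (ζ ^ 2 + (ζ⁻¹) ^ 2) / 2))
      (Metric.sphere 0 1) := by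
    intro ζ hζ
    have hζ1 : ‖ζ‖ = 1 := by simpa using hζ
    have hζ0 : ζ ≠ 0 := norm_ne_zero_iff.1 (by rw [hζ1]; exact one_ne_zero)
    refine (ContinuousAt.mul (hasDerivAt_log_one_sub_div hw hζ1.le).continuousAt
      ?_).continuousWithinAt
    exact continuousAt_const.sub
      (((continuousAt_id.pow 2).add ((continuousAt_id.inv₀ hζ0).pow 2)).div_const 2)
  have h2 := Complex.reCLM.circleAverage_comp_comm (hc.circleIntegrable zero_le_one)
  rw [h] at h2
  rw [← Real.circleAverage_congr_sphere (f₁ := Complex.reCLM ∘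
    fun ζ => Complex.log (1 - ζ / w) * (1 - (ζ ^ 2 + (ζ⁻¹) ^ 2) / 2)), h2]
  · rw [Complex.reCLM_apply, show (1 / (4 * w ^ 2) : ℂ) = ((1 / 4 : ℝ) : ℂ) * (w⁻¹) ^ 2 by
      push_cast
      field_simp, Complex.re_ofReal_mul]
  · intro ζ hζ
    have hζ1 : ‖ζ‖ = 1 := by simpa using hζ
    have h3 : (ζ ^ 2 + (ζ⁻¹) ^ 2) / 2 = (((ζ ^ 2).re : ℝ) : ℂ) := by
      rw [inv_eq_conj_of_mem_sphere hζ1, ← map_pow, Complex.re_eq_add_conj]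
    simp only [Function.comp, Complex.reCLM_apply]
    rw [h3, ← Complex.ofReal_one, ← Complex.ofReal_sub, Complex.re_mul_ofReal, Complex.log_re]

lemma circleAverage_one_sub_re_sq :
    Real.circleAverage (fun ζ : ℂ => 1 - (ζ ^ 2).re) 0 1 = 1 := by
  have hd : Differentiable ℂ (fun ζ : ℂ => 1 - ζ ^ 2) := by fun_prop
  have h1 := (hd.diffContOnCl (s := Metric.ball 0 |1|)).circleAverage
  have h2 := Complex.reCLM.circleAverage_comp_comm (c := 0) (R := 1)
    (hd.continuous.continuousOn.circleIntegrable zero_le_one)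
  rw [h1] at h2
  have h3 : (Complex.reCLM ∘ fun ζ : ℂ => 1 - ζ ^ 2) = fun ζ : ℂ => 1 - (ζ ^ 2).re := by
    ext ζ
    simp
  rw [h3] at h2
  rw [h2]
  simp

/-- Factor `z - (ζ + ζ⁻¹) = w (1 - ζ/w) (1 - ζ⁻¹/w)`. The weight is invariant under `ζ ↦ ζ⁻¹` on the
circle, so the last two factors contribute equally. With `ζ = exp(iθ)` the weight is `2 sin² θ`, the
semicircle density in the variable `2 cos θ`. -/
lemma circleAverage_log_norm_sub_add_inv {z : ℂ} (hz : z.im ≠ 0) :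
    Real.circleAverage (fun ζ => Real.log ‖z - (ζ + ζ⁻¹)‖ * (1 - (ζ ^ 2).re)) 0 1 = Psi z := by
  set w := outerRoot z with hwdef
  have hw : 1 < ‖w‖ := one_lt_norm_outerRoot hz
  have hw0 : w ≠ 0 := outerRoot_ne_zero z
  set f : ℂ → ℝ := fun ζ => Real.log ‖1 - ζ / w‖ * (1 - (ζ ^ 2).re) with hf
  have hfc : ∀ ζ : ℂ, ‖ζ‖ = 1 → ContinuousAt f ζ := by
    intro ζ hζ
    have h0 := one_sub_div_ne_zero hw hζ.le
    refine ContinuousAt.mul (ContinuousAt.log (by fun_prop) (by simpa using h0)) (by fun_prop)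
  have h1 : CircleIntegrable f 0 1 :=
    ContinuousOn.circleIntegrable zero_le_one fun ζ hζ =>
      (hfc ζ (by simpa using hζ)).continuousWithinAt
  have h2 : CircleIntegrable (fun ζ => f ζ⁻¹) 0 1 :=
    ContinuousOn.circleIntegrable zero_le_one fun ζ hζ => by
      have hζ1 : ‖ζ‖ = 1 := by simpa using hζ
      have hζ0 : ζ ≠ 0 := norm_ne_zero_iff.1 (by rw [hζ1]; exact one_ne_zero)
      exact (ContinuousAt.comp (f := fun ζ => ζ⁻¹) (g := f) (hfc _ (by simp [hζ1]))
        (continuousAt_inv₀ hζ0)).continuousWithinAt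
  have h3 : CircleIntegrable (fun ζ : ℂ => Real.log ‖w‖ • (1 - (ζ ^ 2).re)) 0 1 :=
    Continuous.continuousOn (by fun_prop) |>.circleIntegrable zero_le_one
  have h4 : Real.circleAverage (fun ζ => f ζ⁻¹) 0 1 = Real.circleAverage f 0 1 :=
    Real.circleAverage_zero_one_congr_inv
  rw [Real.circleAverage_congr_sphere (f₂ := fun ζ =>
    (Real.log ‖w‖ • (1 - (ζ ^ 2).re) + f ζ) + f ζ⁻¹),
    Real.circleAverage_fun_add (h3.fun_add h1) h2, Real.circleAverage_fun_add h3 h1, h4,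
    circleAverage_log_norm_one_sub_div hw, Real.circleAverage_fun_smul,
    circleAverage_one_sub_re_sq, Psi_eq_outerRoot, ← hwdef]
  · simp only [smul_eq_mul]
    ring
  · intro ζ hζ
    have hζ1 : ‖ζ‖ = 1 := by simpa using hζ
    have hζ0 : ζ ≠ 0 := norm_ne_zero_iff.1 (by rw [hζ1]; exact one_ne_zero)
    have h5 : z - (ζ + ζ⁻¹) = w * (1 - ζ / w) * (1 - ζ⁻¹ / w) := by
      rw [← outerRoot_add_inv z, ← hwdef]
      field_simp
      ring
    have h6 : ((ζ⁻¹) ^ 2).re = (ζ ^ 2).re := by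
      rw [inv_eq_conj_of_mem_sphere hζ1, ← map_pow, Complex.conj_re]
    have h7 := one_sub_div_ne_zero hw hζ1.le
    have h8 := one_sub_div_ne_zero (ζ := ζ⁻¹) hw (by simp [hζ1])
    simp only [hf, h6, smul_eq_mul]
    rw [h5, norm_mul, norm_mul, Real.log_mul (by simp [hw0, h7]) (by simpa using h8),
      Real.log_mul (by simpa using hw0) (by simpa using h7)]
    ring

lemma integral_log_norm_sub_two_cos {z : ℂ} (hz : z.im ≠ 0) :
    ∫ θ in (0)..Real.pi, Real.log ‖z - (2 * Real.cos θ : ℝ)‖ * (2 * Real.sin θ ^ 2) =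
      Real.pi * Psi z := by
  set F : ℝ → ℝ := fun θ => Real.log ‖z - (2 * Real.cos θ : ℝ)‖ * (2 * Real.sin θ ^ 2) with hF
  have hFc : Continuous F := by
    refine Continuous.mul (Continuous.log (by fun_prop) fun θ h => hz ?_) (by fun_prop)
    rw [norm_eq_zero, sub_eq_zero] at h
    rw [h, Complex.ofReal_im]
  have h := circleAverage_log_norm_sub_add_inv hz
  rw [Real.circleAverage_def] at h
  have h1 : ∀ θ : ℝ, (fun ζ => Real.log ‖z - (ζ + ζ⁻¹)‖ * (1 - (ζ ^ 2).re)) (circleMap 0 1 θ) =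
      F θ := by
    intro θ
    have h2 : circleMap 0 1 θ = Complex.exp (θ * Complex.I) := by simp [circleMap]
    have h3 : (Complex.exp (θ * Complex.I))⁻¹ = Complex.exp (-θ * Complex.I) := by
      rw [← Complex.exp_neg]
      ring_nf
    simp only [hF]
    rw [h2, h3, ← Complex.two_cos, ← Complex.exp_nat_mul,
      show ((2 : ℕ) : ℂ) * (θ * Complex.I) = ((2 * θ : ℝ) : ℂ) * Complex.I by push_cast; ring,
      Complex.exp_ofReal_mul_I_re, Real.cos_two_mul, Real.cos_sq']
    push_cast
    ring_nf
  simp only [h1, smul_eq_mul] at h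
  -- The reflection `θ ↦ 2π - θ` folds the full circle onto the upper half.
  have h4 : ∫ θ in Real.pi..(2 * Real.pi), F θ = ∫ θ in (0)..Real.pi, F θ := by
    have h5 := intervalIntegral.integral_comp_sub_left (a := 0) (b := Real.pi) F (2 * Real.pi)
    rw [sub_zero, show 2 * Real.pi - Real.pi = Real.pi by ring] at h5
    rw [← h5]
    refine intervalIntegral.integral_congr fun θ _ => ?_
    simp only [hF, Real.cos_two_pi_sub, Real.sin_two_pi_sub, neg_sq]
  rw [← intervalIntegral.integral_add_adjacent_intervals (b := Real.pi)
    (hFc.intervalIntegrable _ _) (hFc.intervalIntegrable _ _), h4] at h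
  rw [← h]
  have := Real.pi_ne_zero
  field_simp
  ring

lemma integral_two_sin_sq : ∫ θ in (0)..Real.pi, 2 * Real.sin θ ^ 2 = Real.pi := by
  rw [intervalIntegral.integral_const_mul, integral_sin_sq]
  simp
  ring

lemma measurable_semicircle_density (t : ℝ) :
    Measurable fun x : ℝ => ENNReal.ofReal (√(4 * t - x ^ 2) / (2 * Real.pi * t)) := by
  fun_prop

/-- Substitute `x = 2√t cos θ`. The density and the Jacobian each supply a factor `2√t sin θ`. -/
lemma integral_semicircle {t : ℝ} (ht : 0 < t) {g : ℂ → ℝ}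
    (hg : ContinuousOn (fun x : ℝ => g x) (Icc (-2 * √t) (2 * √t)))
    (hgm : AEStronglyMeasurable g (semicircle t)) :
    ∫ x, g x ∂(semicircle t) =
      (1 / Real.pi) * ∫ θ in (0)..Real.pi,
        g ((2 * √t * Real.cos θ : ℝ) : ℂ) * (2 * Real.sin θ ^ 2) := by
  have hs : 0 < √t := Real.sqrt_pos.2 ht
  rw [semicircle] at hgm ⊢
  rw [integral_map (Complex.measurable_ofReal.aemeasurable) hgm,
    integral_withDensity_eq_integral_toReal_smul (measurable_semicircle_density t)
      (Eventually.of_forall fun x => ENNReal.ofReal_lt_top)]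
  have h1 : ∀ x : ℝ, (ENNReal.ofReal (√(4 * t - x ^ 2) / (2 * Real.pi * t))).toReal • g x =
      g x * (√(4 * t - x ^ 2) / (2 * Real.pi * t)) := by
    intro x
    rw [ENNReal.toReal_ofReal (by positivity), smul_eq_mul, mul_comm]
  simp only [h1]
  rw [integral_Icc_eq_integral_Ioc, ← intervalIntegral.integral_of_le (by linarith)]
  have hd : ∀ θ : ℝ, HasDerivAt (fun θ => 2 * √t * Real.cos θ) (2 * √t * (-Real.sin θ)) θ :=
    fun θ => (Real.hasDerivAt_cos θ).const_mul _
  have himg : (fun θ => 2 * √t * Real.cos θ) '' uIcc 0 Real.pi ⊆ Icc (-2 * √t) (2 * √t) := by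
    rintro _ ⟨θ, -, rfl⟩
    have h2 := Real.neg_one_le_cos θ
    have h3 := Real.cos_le_one θ
    constructor <;> nlinarith
  have hsub := intervalIntegral.integral_comp_mul_deriv' (a := 0) (b := Real.pi)
    (f := fun θ => 2 * √t * Real.cos θ) (f' := fun θ => 2 * √t * (-Real.sin θ))
    (g := fun x : ℝ => g x * (√(4 * t - x ^ 2) / (2 * Real.pi * t))) (fun θ _ => hd θ)
    (by fun_prop) ((hg.mono himg).mul (by fun_prop))
  simp only [Real.cos_zero, Real.cos_pi, mul_one, mul_neg] at hsub
  rw [show -2 * √t = -(2 * √t) by ring, intervalIntegral.integral_symm, ← hsub,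
    ← intervalIntegral.integral_neg, ← intervalIntegral.integral_const_mul]
  refine intervalIntegral.integral_congr fun θ hθ => ?_
  rw [uIcc_of_le Real.pi_pos.le] at hθ
  have hsin := Real.sin_nonneg_of_mem_Icc hθ
  have h2 : √(4 * t - (2 * √t * Real.cos θ) ^ 2) = 2 * √t * Real.sin θ := by
    rw [show 4 * t - (2 * √t * Real.cos θ) ^ 2 = (2 * √t * Real.sin θ) ^ 2 by
      have h3 := Real.sq_sqrt ht.le
      have h4 := Real.sin_sq_add_cos_sq θ
      linear_combination (-4 * (Real.cos θ ^ 2 + Real.sin θ ^ 2)) * h3 - 4 * t * h4,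
      Real.sqrt_sq (by positivity)]
  simp only [Function.comp]
  rw [h2]
  have h3 := Real.sq_sqrt ht.le
  have := Real.pi_ne_zero
  field_simp
  rw [h3]
  ring

lemma integral_log_semicircle {t : ℝ} (ht : 0 < t) {z : ℂ} (hz : (z / ((√t : ℝ) : ℂ)).im ≠ 0) :
    ∫ x, Real.log ‖z - x‖ ∂(semicircle t) = Real.log √t + Psi (z / ((√t : ℝ) : ℂ)) := by
  have hs : 0 < √t := Real.sqrt_pos.2 ht
  have hs0 : ((√t : ℝ) : ℂ) ≠ 0 := by exact_mod_cast hs.ne'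
  set u := z / ((√t : ℝ) : ℂ) with hu
  have hne : ∀ y : ℝ, u - (y : ℂ) ≠ 0 := fun y h => hz (by
    rw [sub_eq_zero] at h
    rw [h, Complex.ofReal_im])
  have hzu : ∀ y : ℝ, z - ((√t * y : ℝ) : ℂ) = ((√t : ℝ) : ℂ) * (u - y) := by
    intro y
    rw [hu]
    push_cast
    field_simp
  have hlog : ∀ y : ℝ, Real.log ‖z - ((√t * y : ℝ) : ℂ)‖ = Real.log √t + Real.log ‖u - y‖ := by
    intro y
    rw [hzu, norm_mul, Complex.norm_real, Real.norm_eq_abs, abs_of_pos hs,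
      Real.log_mul hs.ne' (norm_ne_zero_iff.2 (hne y))]
  rw [integral_semicircle ht (g := fun x => Real.log ‖z - x‖)]
  · have h1 : ∀ θ : ℝ, Real.log ‖z - ((2 * √t * Real.cos θ : ℝ) : ℂ)‖ * (2 * Real.sin θ ^ 2) =
        Real.log √t * (2 * Real.sin θ ^ 2) +
          Real.log ‖u - (2 * Real.cos θ : ℝ)‖ * (2 * Real.sin θ ^ 2) := by
      intro θ
      rw [show 2 * √t * Real.cos θ = √t * (2 * Real.cos θ) by ring, hlog]
      ring
    have hc : Continuous fun θ : ℝ =>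
        Real.log ‖u - (2 * Real.cos θ : ℝ)‖ * (2 * Real.sin θ ^ 2) :=
      Continuous.mul (Continuous.log (by fun_prop) fun θ => norm_ne_zero_iff.2 (hne _))
        (by fun_prop)
    simp only [h1]
    rw [intervalIntegral.integral_add (Continuous.intervalIntegrable (by fun_prop) _ _)
      (hc.intervalIntegrable _ _), integral_log_norm_sub_two_cos hz,
      intervalIntegral.integral_const_mul, integral_two_sin_sq]
    have := Real.pi_ne_zero
    field_simp
  · refine Continuous.continuousOn (Continuous.log (by fun_prop) fun x => ?_)
    have h2 := hzu (x / √t)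
    rw [mul_div_cancel₀ _ hs.ne'] at h2
    rw [h2]
    exact norm_ne_zero_iff.2 (mul_ne_zero hs0 (hne _))
  · exact (Real.measurable_log.comp (by fun_prop)).aestronglyMeasurable

instance isFiniteMeasure_semicircle (t : ℝ) : IsFiniteMeasure (semicircle t) := by
  rw [semicircle]
  have : IsFiniteMeasure ((volume.restrict (Icc (-2 * √t) (2 * √t))).withDensity
      (fun x : ℝ => ENNReal.ofReal (√(4 * t - x ^ 2) / (2 * Real.pi * t)))) := by
    refine isFiniteMeasure_withDensity_ofReal ?_
    exact (Continuous.continuousOn (by fun_prop)).integrableOn_Icc.2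
  infer_instance

lemma isClosed_realSegment (a b : ℝ) : IsClosed (realSegment a b) :=
  (isCompact_Icc.image Complex.continuous_ofReal).isClosed

lemma ae_mem_realSegment_semicircle (t : ℝ) :
    ∀ᵐ x ∂(semicircle t), x ∈ realSegment (-(2 * √t)) (2 * √t) := by
  rw [semicircle]
  refine (ae_map_iff Complex.measurable_ofReal.aemeasurable
    (isClosed_realSegment _ _).measurableSet).2 ?_
  refine (withDensity_absolutelyContinuous _ _).ae_le ?_
  filter_upwards [ae_restrict_mem measurableSet_Icc] with x hx
  exact mem_image_of_mem _ (by rwa [show -2 * √t = -(2 * √t) by ring] at hx)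

/-! ### Uniform bounds for logarithmic kernels and Laplacians of logarithmic potentials -/

lemma integrableOn_sq_log_norm_sub {R S : ℝ} {ζ : ℂ} (hζ : ‖ζ‖ ≤ R) :
    IntegrableOn (fun z : ℂ => Real.log ‖z - ζ‖ ^ 2) (Metric.ball 0 S) ∧
      ∫ z in Metric.ball 0 S, Real.log ‖z - ζ‖ ^ 2 ≤
        ∫ z in Metric.ball (0 : ℂ) (R + S), Real.log ‖z‖ ^ 2 := by
  have hsub : Metric.ball (0 : ℂ) S ⊆ Metric.ball ζ (R + S) := by
    refine Metric.ball_subset_ball' ?_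
    rw [dist_zero_left]
    linarith
  have hind : (Metric.ball ζ (R + S)).indicator (fun z : ℂ => Real.log ‖z - ζ‖ ^ 2) =
      fun z => (Metric.ball (0 : ℂ) (R + S)).indicator (fun z => Real.log ‖z‖ ^ 2) (z - ζ) := by
    ext z
    simp only [indicator, mem_ball_iff_norm, sub_zero]
  have h1 : IntegrableOn (fun z : ℂ => Real.log ‖z - ζ‖ ^ 2) (Metric.ball ζ (R + S)) := by
    rw [← integrable_indicator_iff measurableSet_ball, hind]
    exact ((integrable_indicator_iff measurableSet_ball).2
      (integrable_indicator_sq_log_norm (R + S))).comp_sub_right ζ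
  refine ⟨h1.mono_set hsub, (setIntegral_mono_set h1
    (Eventually.of_forall fun z => sq_nonneg _) hsub.eventuallyLE).trans (le_of_eq ?_)⟩
  rw [← integral_indicator measurableSet_ball, hind, ← integral_indicator measurableSet_ball]
  exact integral_sub_right_eq_self _ ζ

lemma exists_bound_of_hasCompactSupport {ψ : ℂ → ℝ} (hψ : Continuous ψ)
    (hc : HasCompactSupport ψ) :
    ∃ S C : ℝ, 0 ≤ C ∧ ∀ z, |ψ z| ≤ (Metric.ball (0 : ℂ) S).indicator (fun _ => C) z := by
  obtain ⟨C, hC⟩ := hψ.bounded_above_of_compact_support hc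
  obtain ⟨S, hS⟩ := hc.isCompact.isBounded.subset_ball 0
  refine ⟨S, C, (norm_nonneg _).trans (hC 0), fun z => ?_⟩
  by_cases hz : z ∈ Metric.ball (0 : ℂ) S
  · rw [indicator_of_mem hz]
    exact hC z
  · rw [indicator_of_notMem hz, image_eq_zero_of_notMem_tsupport fun h => hz (hS h), abs_zero]

/-- From `|log| ≤ 1 + log²` and the local `L²` bound. The constant does not depend on the pole `ζ`,
which is what Fubini needs when integrating over poles. -/
lemma exists_integrable_log_mul_bound {ψ : ℂ → ℝ} (hψ : Continuous ψ)
    (hc : HasCompactSupport ψ) (R : ℝ) :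
    ∃ B : ℝ, ∀ ζ : ℂ, ‖ζ‖ ≤ R → Integrable (fun z => Real.log ‖z - ζ‖ * ψ z) ∧
      ∫ z, ‖Real.log ‖z - ζ‖ * ψ z‖ ≤ B := by
  obtain ⟨S, C, hC0, hC⟩ := exists_bound_of_hasCompactSupport hψ hc
  refine ⟨(∫ z in Metric.ball (0 : ℂ) S, C) +
    C * ∫ z in Metric.ball (0 : ℂ) (R + S), Real.log ‖z‖ ^ 2, fun ζ hζ => ?_⟩
  obtain ⟨h1, h2⟩ := integrableOn_sq_log_norm_sub (S := S) hζ
  have hCi : IntegrableOn (fun _ : ℂ => C) (Metric.ball 0 S) :=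
    integrableOn_const (by exact measure_ball_lt_top.ne)
  have h3 : IntegrableOn (fun z : ℂ => C + C * Real.log ‖z - ζ‖ ^ 2) (Metric.ball 0 S) :=
    hCi.add (h1.const_mul C)
  have h4 := (integrable_indicator_iff Metric.isOpen_ball.measurableSet).2 h3
  have hle : ∀ z, ‖Real.log ‖z - ζ‖ * ψ z‖ ≤
      (Metric.ball (0 : ℂ) S).indicator (fun z => C + C * Real.log ‖z - ζ‖ ^ 2) z := by
    intro z
    have h5 := hC z
    rw [norm_mul, Real.norm_eq_abs, Real.norm_eq_abs]
    by_cases hz : z ∈ Metric.ball (0 : ℂ) S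
    · rw [indicator_of_mem hz] at h5 ⊢
      have h6 : |Real.log ‖z - ζ‖| ≤ 1 + Real.log ‖z - ζ‖ ^ 2 := by
        nlinarith [sq_abs (Real.log ‖z - ζ‖), sq_nonneg (|Real.log ‖z - ζ‖| - 1),
          sq_nonneg (Real.log ‖z - ζ‖)]
      calc |Real.log ‖z - ζ‖| * |ψ z| ≤ (1 + Real.log ‖z - ζ‖ ^ 2) * C := by gcongr
        _ = C + C * Real.log ‖z - ζ‖ ^ 2 := by ring
    · rw [indicator_of_notMem hz] at h5 ⊢
      have h6 : |ψ z| = 0 := le_antisymm h5 (abs_nonneg _)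
      rw [h6, mul_zero]
  have hmeas : Measurable fun z => Real.log ‖z - ζ‖ * ψ z :=
    (Real.measurable_log.comp (by fun_prop)).mul hψ.measurable
  refine ⟨h4.mono' hmeas.aestronglyMeasurable (Eventually.of_forall hle), ?_⟩
  have h5 := integral_mono_of_nonneg (Eventually.of_forall fun z =>
    norm_nonneg (Real.log ‖z - ζ‖ * ψ z)) h4 (Eventually.of_forall hle)
  refine h5.trans ?_
  rw [integral_indicator Metric.isOpen_ball.measurableSet, integral_add hCi (h1.const_mul C),
    integral_const_mul]
  gcongr

lemma integral_logPotential_mul_laplacian (m : Measure ℂ) [IsFiniteMeasure m] {R : ℝ}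
    (hR : ∀ᵐ x ∂m, ‖x‖ ≤ R) {φ : ℂ → ℝ} (hφ : ContDiff ℝ ∞ φ) (hc : HasCompactSupport φ) :
    ∫ z, (∫ x, Real.log ‖z - x‖ ∂m) * Laplacian.laplacian φ z = 2 * Real.pi * ∫ x, φ x ∂m := by
  set ψ := Laplacian.laplacian φ with hψdef
  have hψ : Continuous ψ := continuous_laplacian hφ
  have hψc : HasCompactSupport ψ := hasCompactSupport_laplacian hc
  obtain ⟨B, hB⟩ := exists_integrable_log_mul_bound hψ hψc R
  have hmeas : Measurable fun p : ℂ × ℂ => Real.log ‖p.2 - p.1‖ * ψ p.2 :=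
    (Real.measurable_log.comp (by fun_prop)).mul (hψ.measurable.comp measurable_snd)
  have hint : Integrable (fun p : ℂ × ℂ => Real.log ‖p.2 - p.1‖ * ψ p.2) (m.prod volume) := by
    rw [integrable_prod_iff hmeas.aestronglyMeasurable]
    refine ⟨?_, ?_⟩
    · filter_upwards [hR] with x hx using (hB x hx).1
    · refine Integrable.mono' (integrable_const B)
        hmeas.aestronglyMeasurable.norm.integral_prod_right' ?_
      filter_upwards [hR] with x hx
      rw [Real.norm_of_nonneg (integral_nonneg fun _ => norm_nonneg _)]
      exact (hB x hx).2
  have h1 := integral_integral_swap (f := fun x z => Real.log ‖z - x‖ * ψ z) hint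
  simp only [integral_log_norm_sub_mul_laplacian hφ hc, integral_mul_const,
    integral_const_mul, hψdef] at h1
  exact h1.symm

/-- Integration by parts against the constant `1`. Consequently additive constants in a potential,
such as `log √|t|`, do not affect its Riesz measure. -/
lemma integral_laplacian_eq_zero {φ : ℂ → ℝ} (hφ : ContDiff ℝ ∞ φ) (hc : HasCompactSupport φ) :
    ∫ z, Laplacian.laplacian φ z = 0 := by
  have hD : ContDiff ℝ ∞ (fderiv ℝ φ) := hφ.fderiv_right (by simp)
  have key : ∀ v : ℂ, Integrable (fun z => fderiv ℝ (fderiv ℝ φ) z v v) ∧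
      ∫ z, fderiv ℝ (fderiv ℝ φ) z v v = 0 := by
    intro v
    have hg : ContDiff ℝ ∞ (fun z => fderiv ℝ φ z v) := hD.clm_apply contDiff_const
    have hgc : HasCompactSupport (fun z => fderiv ℝ φ z v) :=
      hc.fderiv_apply (𝕜 := ℝ) v
    have hgd : ∀ z, fderiv ℝ (fun z => fderiv ℝ φ z v) z v = fderiv ℝ (fderiv ℝ φ) z v v := by
      intro z
      rw [fderiv_clm_apply (hD.differentiable (by simp) z) (differentiableAt_const v)]
      simp
    have hi : Integrable (fun z => fderiv ℝ (fun z => fderiv ℝ φ z v) z v) :=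
      ((hg.continuous_fderiv (by simp)).clm_apply continuous_const).integrable_of_hasCompactSupport
        (hgc.fderiv_apply (𝕜 := ℝ) v)
    have h := integral_mul_fderiv_eq_neg_fderiv_mul_of_integrable (μ := volume) (v := v)
      (f := fun _ : ℂ => (1 : ℝ)) (g := fun z => fderiv ℝ φ z v) (by simp) (by simpa using hi)
      (by simpa using hg.continuous.integrable_of_hasCompactSupport hgc)
      (fun z _ => differentiableAt_const _) (fun z _ => hg.differentiable (by simp) z)
    simp only [hgd, one_mul, fderiv_fun_const] at h hi
    refine ⟨hi, by simpa using h⟩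
  rw [funext (laplacian_eq_fderiv_fderiv φ), integral_add (key 1).1 (key Complex.I).1,
    (key 1).2, (key Complex.I).2, add_zero]

lemma volume_preimage_div_eq_zero {a : ℂ} (ha : a ≠ 0) {N : Set ℂ} (hN : volume N = 0) :
    volume ((fun z => z / a) ⁻¹' N) = 0 := by
  have hdet : LinearMap.det (LinearMap.mulLeft ℝ a⁻¹) ≠ 0 := by
    intro h
    obtain ⟨x, hx, hx0⟩ := (Submodule.ne_bot_iff _).1 (LinearMap.bot_lt_ker_of_det_eq_zero h).ne'
    simp at hx
    exact hx.elim ha hx0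
  have h := Measure.addHaar_preimage_linearMap volume hdet N
  rw [hN, mul_zero] at h
  rw [← h]
  congr 2
  ext z
  simp [div_eq_inv_mul]

lemma ae_im_div_ne_zero {a : ℂ} (ha : a ≠ 0) : ∀ᵐ z : ℂ, (z / a).im ≠ 0 := by
  have h : volume {z : ℂ | z.im = 0} = 0 := by
    have h1 := Measure.addHaar_submodule (volume : Measure ℂ) (LinearMap.ker Complex.imLm) fun h => by
      have : Complex.I ∈ LinearMap.ker Complex.imLm := by rw [h]; trivial
      simp at this
    exact h1
  rw [ae_iff]
  simpa using volume_preimage_div_eq_zero ha h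

lemma ae_Psi_div_ne {a : ℂ} (ha : a ≠ 0) (c : ℝ) : ∀ᵐ z : ℂ, Psi (z / a) ≠ c := by
  rw [ae_iff]
  simpa using volume_preimage_div_eq_zero ha (volume_Psi_eq c)

/-- The Laplacian of `Psi (z / √t)` is the semicircle law, up to the factor `2π`. -/
lemma integral_Psi_mul_laplacian {t : ℝ} (ht : 0 < t) {φ : ℂ → ℝ} (hφ : ContDiff ℝ ∞ φ)
    (hc : HasCompactSupport φ) :
    ∫ z, Psi (z / ((√t : ℝ) : ℂ)) * Laplacian.laplacian φ z =
      2 * Real.pi * ∫ x, φ x ∂(semicircle t) := by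
  have hs0 : ((√t : ℝ) : ℂ) ≠ 0 := by exact_mod_cast (Real.sqrt_pos.2 ht).ne'
  have hL := continuous_laplacian hφ
  have hLc := hasCompactSupport_laplacian hc
  rw [← integral_logPotential_mul_laplacian (semicircle t) (R := 2 * √t) ?_ hφ hc]
  · have h1 : (fun z => (∫ x, Real.log ‖z - x‖ ∂(semicircle t)) * Laplacian.laplacian φ z) =ᵐ[volume]
        fun z => Real.log √t * Laplacian.laplacian φ z +
          Psi (z / ((√t : ℝ) : ℂ)) * Laplacian.laplacian φ z := by
      filter_upwards [ae_im_div_ne_zero hs0] with z hz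
      rw [integral_log_semicircle ht hz, add_mul]
    rw [integral_congr_ae h1, integral_add, integral_const_mul, integral_laplacian_eq_zero hφ hc,
      mul_zero, zero_add]
    · exact (hL.integrable_of_hasCompactSupport hLc).const_mul _
    · exact ((continuous_Psi.comp (by fun_prop)).mul hL).integrable_of_hasCompactSupport
        hLc.mul_left
  · filter_upwards [ae_mem_realSegment_semicircle t] with x hx
    obtain ⟨y, hy, rfl⟩ := hx
    rw [Complex.norm_real, Real.norm_eq_abs]
    exact abs_le.2 hy

/-! ### Convergence of the zero distributions against test functions -/

section EvolvedPoly

lemma evolvedPoly_eq (r : ℝ) (t : ℂ) (n : ℕ) :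
    evolvedPoly r t n = scaledHermite (t / n) n - Polynomial.C ((r : ℂ) ^ n) := by
  rw [evolvedPoly, heatFlow_sub_C, scaledHermite]

lemma evolvedPoly_monic_natDegree (r : ℝ) (t : ℂ) {n : ℕ} (hn : 1 ≤ n) :
    (evolvedPoly r t n).Monic ∧ (evolvedPoly r t n).natDegree = n := by
  obtain ⟨h1, h2⟩ := scaledHermite_monic_natDegree (t / n) n
  rw [evolvedPoly_eq]
  refine ⟨h1.sub_of_left ?_, by rw [Polynomial.natDegree_sub_C, h2]⟩
  refine lt_of_le_of_lt Polynomial.degree_C_le ?_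
  rw [Polynomial.degree_eq_natDegree h1.ne_zero, h2]
  exact_mod_cast hn

lemma eval_evolvedPoly (r : ℝ) {t a : ℂ} (ha : a ≠ 0) (hat : a ^ 2 = t) (n : ℕ) (z : ℂ) :
    (evolvedPoly r t n).eval z =
      a ^ n * (scaledHermite (1 / n) n).eval (z / a) - (r : ℂ) ^ n := by
  rw [evolvedPoly_eq, Polynomial.eval_sub, Polynomial.eval_C, ← eval_scaledHermite_scale,
    mul_div_cancel₀ _ ha, hat, mul_one_div]

/-- At a zero the Hermite term has modulus `r ^ n`, whereas for `|z| ≥ 2√|t|` it is at least `(|z| /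
2) ^ n`. The disc is independent of `n`, which gives tightness and the uniform `L²` bound. -/
lemma norm_le_of_isRoot_evolvedPoly {r : ℝ} (hr : 0 < r) {t : ℂ} (ht : t ≠ 0) {n : ℕ} (hn : 1 ≤ n)
    {z : ℂ} (hz : (evolvedPoly r t n).eval z = 0) : ‖z‖ ≤ max (2 * √‖t‖) (2 * r) := by
  set a := t ^ (1 / 2 : ℂ) with ha
  have ha0 : a ≠ 0 := cpow_half_ne_zero ht
  have hna : ‖a‖ = √‖t‖ := norm_cpow_half t
  have hpos : 0 < ‖a‖ := norm_pos_iff.2 ha0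
  rw [eval_evolvedPoly r ha0 (cpow_half_sq t), sub_eq_zero] at hz
  by_contra! h
  obtain ⟨h1, h2⟩ := max_lt_iff.1 h
  have h3 : 2 ≤ ‖z / a‖ := by
    rw [norm_div, le_div_iff₀ hpos, hna]
    exact h1.le
  have h4 := half_norm_pow_le_scaledHermite n h3
  have h5 := congrArg norm hz
  rw [norm_mul, norm_pow, norm_pow, Complex.norm_real, Real.norm_eq_abs, abs_of_pos hr] at h5
  have h6 : (‖z‖ / 2) ^ n ≤ r ^ n := by
    rw [← h5]
    calc (‖z‖ / 2) ^ n = ‖a‖ ^ n * (‖z / a‖ / 2) ^ n := by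
          rw [← mul_pow, norm_div]
          congr 1
          field_simp
      _ ≤ _ := by gcongr
  have h7 := (pow_le_pow_iff_left₀ (by positivity) hr.le (by omega)).1 h6
  linarith

lemma exists_fin_roots {P : Polynomial ℂ} (hP : P.Monic) {n : ℕ} (hn : P.natDegree = n) :
    ∃ ζ : Fin n → ℂ, P.roots = Finset.univ.val.map ζ ∧ (∀ z, P.eval z = ∏ i, (z - ζ i)) ∧
      ∀ i, P.eval (ζ i) = 0 := by
  have hs := IsAlgClosed.splits P
  have hcard : P.roots.toList.length = n := by
    rw [Multiset.length_toList, ← hs.natDegree_eq_card_roots, hn]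
  have hroots : P.roots = Finset.univ.val.map (fun i : Fin n => P.roots.toList.get (i.cast hcard.symm)) := by
    subst hcard
    conv_lhs => rw [← Multiset.coe_toList P.roots, ← List.ofFn_get P.roots.toList]
    simp [Fin.univ_val_map]
  refine ⟨_, hroots, fun z => ?_, fun i => ?_⟩
  · rw [hs.eval_eq_prod_roots_of_monic hP]
    nth_rewrite 1 [hroots]
    rw [Multiset.map_map]
    rfl
  · have : P.roots.toList.get (i.cast hcard.symm) ∈ P.roots :=
      Multiset.mem_toList.1 (List.get_mem _ _)
    exact (Polynomial.mem_roots hP.ne_zero).1 this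

lemma zeroDistribution_eq_sum {P : Polynomial ℂ} {n : ℕ} (hn : P.natDegree = n) {ζ : Fin n → ℂ}
    (hζ : P.roots = Finset.univ.val.map ζ) :
    (zeroDistribution P : Measure ℂ) = ((n : ℝ≥0)⁻¹) • ∑ i, Measure.dirac (ζ i) := by
  rw [zeroDistribution, hζ, hn, Multiset.map_map]
  change (((n : ℝ≥0)⁻¹ • ∑ i, (diracProba (ζ i)).toFiniteMeasure : FiniteMeasure ℂ) : Measure ℂ) = _
  rw [FiniteMeasure.toMeasure_smul, FiniteMeasure.toMeasure_sum]
  rfl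

lemma integral_zeroDistribution {P : Polynomial ℂ} {n : ℕ} (hn : P.natDegree = n) {ζ : Fin n → ℂ}
    (hζ : P.roots = Finset.univ.val.map ζ) (f : ℂ → ℝ) :
    ∫ x, f x ∂(zeroDistribution P : Measure ℂ) = (1 / n) * ∑ i, f (ζ i) := by
  rw [zeroDistribution_eq_sum hn hζ, integral_smul_nnreal_measure,
    integral_finsetSum_measure fun i _ => integrable_dirac (by simp)]
  simp [NNReal.smul_def]

lemma isProbabilityMeasure_zeroDistribution_evolvedPoly (r : ℝ) (t : ℂ) {n : ℕ} (hn : 1 ≤ n) :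
    IsProbabilityMeasure (zeroDistribution (evolvedPoly r t n) : Measure ℂ) := by
  obtain ⟨hm, hd⟩ := evolvedPoly_monic_natDegree r t hn
  obtain ⟨ζ, hζ, -, -⟩ := exists_fin_roots hm hd
  constructor
  rw [zeroDistribution_eq_sum hd hζ]
  have h0 : (n : ℝ≥0) ≠ 0 := by exact_mod_cast (by omega : n ≠ 0)
  simp only [Measure.smul_apply, Measure.finsetSum_apply, measure_univ, Finset.sum_const,
    Finset.card_univ, Fintype.card_fin, nsmul_eq_mul, mul_one]
  rw [ENNReal.smul_def, smul_eq_mul, ENNReal.coe_inv h0, ENNReal.coe_natCast,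
    ENNReal.inv_mul_cancel (by exact_mod_cast (by omega : n ≠ 0)) (ENNReal.natCast_ne_top n)]

lemma zeroDistribution_compl_closedBall {r : ℝ} (hr : 0 < r) {t : ℂ} (ht : t ≠ 0) {n : ℕ}
    (hn : 1 ≤ n) :
    (zeroDistribution (evolvedPoly r t n) : Measure ℂ)
      (Metric.closedBall 0 (max (2 * √‖t‖) (2 * r)))ᶜ = 0 := by
  obtain ⟨hm, hd⟩ := evolvedPoly_monic_natDegree r t hn
  obtain ⟨ζ, hζ, -, h0⟩ := exists_fin_roots hm hd
  rw [zeroDistribution_eq_sum hd hζ, Measure.smul_apply, Measure.finsetSum_apply,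
    Finset.sum_eq_zero, smul_zero]
  intro i _
  rw [Measure.dirac_apply' _ Metric.isClosed_closedBall.measurableSet.compl, indicator_of_notMem]
  rw [notMem_compl_iff, mem_closedBall_zero_iff]
  exact norm_le_of_isRoot_evolvedPoly hr ht hn (h0 i)

end EvolvedPoly

/-! ### Growth rate of a difference of two exponentially growing sequences -/

section Growth

/-- If `c n` has a strictly larger exponential growth rate than `y n`, then `c n - y n` has the
growth rate of `c n`. -/
lemma tendsto_log_norm_sub_of_lt {y c : ℕ → ℂ} (hy : ∀ n, y n ≠ 0) (hc : ∀ n, c n ≠ 0) {A B : ℝ}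
    (hA : Tendsto (fun n : ℕ => (1 / (n : ℝ)) * Real.log ‖y n‖) atTop (𝓝 A))
    (hB : Tendsto (fun n : ℕ => (1 / (n : ℝ)) * Real.log ‖c n‖) atTop (𝓝 B)) (hAB : A < B) :
    (∀ᶠ n in atTop, c n - y n ≠ 0) ∧
      Tendsto (fun n : ℕ => (1 / (n : ℝ)) * Real.log ‖c n - y n‖) atTop (𝓝 B) := by
  have h1 : Tendsto (fun n : ℕ => (n : ℝ) * ((1 / (n : ℝ)) * Real.log ‖y n‖ -
      (1 / (n : ℝ)) * Real.log ‖c n‖)) atTop atBot :=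
    tendsto_natCast_atTop_atTop.atTop_mul_neg (sub_neg.2 hAB) (hA.sub hB)
  have h2 : Tendsto (fun n : ℕ => ‖y n / c n‖) atTop (𝓝 0) := by
    refine (Real.tendsto_exp_atBot.comp h1).congr' ?_
    filter_upwards [eventually_gt_atTop 0] with n hn
    have hn' : (n : ℝ) ≠ 0 := by exact_mod_cast hn.ne'
    rw [Function.comp, ← mul_sub, ← mul_assoc, mul_one_div_cancel hn', one_mul, norm_div,
      Real.exp_sub, Real.exp_log (norm_pos_iff.2 (hy n)), Real.exp_log (norm_pos_iff.2 (hc n))]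
  have h3 : Tendsto (fun n : ℕ => 1 - y n / c n) atTop (𝓝 1) := by
    simpa using (tendsto_zero_iff_norm_tendsto_zero.2 h2).const_sub 1
  have h4 : ∀ᶠ n in atTop, 1 - y n / c n ≠ 0 := h3.eventually_ne one_ne_zero
  have h5 : ∀ n, c n - y n = c n * (1 - y n / c n) := by
    intro n
    have := hc n
    field_simp
  refine ⟨?_, ?_⟩
  · filter_upwards [h4] with n hn
    rw [h5]
    exact mul_ne_zero (hc n) hn
  · have h6 := (h3.norm.log (by simp))
    have h7 := hB.add (tendsto_one_div_atTop_nhds_zero_nat (𝕜 := ℝ) |>.mul h6)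
    rw [zero_mul, add_zero] at h7
    refine h7.congr' ?_
    filter_upwards [h4] with n hn
    rw [h5, norm_mul, Real.log_mul (norm_ne_zero_iff.2 (hc n)) (norm_ne_zero_iff.2 hn)]
    ring

/-- Equal rates must be excluded because of possible cancellation. In the application they occur
only on a null level set of `Psi`. -/
lemma tendsto_log_norm_sub_max {y c : ℕ → ℂ} (hy : ∀ n, y n ≠ 0) (hc : ∀ n, c n ≠ 0) {A B : ℝ}
    (hA : Tendsto (fun n : ℕ => (1 / (n : ℝ)) * Real.log ‖y n‖) atTop (𝓝 A))
    (hB : Tendsto (fun n : ℕ => (1 / (n : ℝ)) * Real.log ‖c n‖) atTop (𝓝 B)) (hAB : A ≠ B) :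
    (∀ᶠ n in atTop, y n - c n ≠ 0) ∧
      Tendsto (fun n : ℕ => (1 / (n : ℝ)) * Real.log ‖y n - c n‖) atTop (𝓝 (max A B)) := by
  rcases hAB.lt_or_gt with h | h
  · rw [max_eq_right h.le]
    have := tendsto_log_norm_sub_of_lt hy hc hA hB h
    simp only [norm_sub_rev] at this ⊢
    refine ⟨?_, this.2⟩
    filter_upwards [this.1] with n hn
    rwa [← neg_ne_zero, neg_sub]
  · rw [max_eq_left h.le]
    exact tendsto_log_norm_sub_of_lt hc hy hB hA h

lemma continuous_potential (r : ℝ) (t : ℂ) : Continuous (potential r t) := by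
  unfold potential
  exact (continuous_Psi.comp (by fun_prop)).max continuous_const

lemma ae_tendsto_log_evolvedPoly {r : ℝ} (hr : 0 < r) {t : ℂ} (ht : t ≠ 0) :
    ∀ᵐ z : ℂ, (∀ᶠ n in atTop, (evolvedPoly r t n).eval z ≠ 0) ∧
      Tendsto (fun n : ℕ => (1 / (n : ℝ)) * Real.log ‖(evolvedPoly r t n).eval z‖) atTop
        (𝓝 (Real.log √‖t‖ + potential r t z)) := by
  set a := t ^ (1 / 2 : ℂ) with ha
  have ha0 : a ≠ 0 := cpow_half_ne_zero ht
  have hna : ‖a‖ = √‖t‖ := norm_cpow_half t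
  have hpos : 0 < √‖t‖ := by rw [← hna]; exact norm_pos_iff.2 ha0
  -- Two null sets are discarded: the line through the segment carrying the Hermite zeros, and the
  -- level set where the rates tie.
  filter_upwards [ae_im_div_ne_zero ha0, ae_Psi_div_ne ha0 (Real.log r - Real.log √‖t‖)]
    with z hz1 hz2
  obtain ⟨h0, hlim⟩ := tendsto_log_scaledHermite hz1
  have hy : Tendsto (fun n : ℕ => (1 / (n : ℝ)) *
      Real.log ‖a ^ n * (scaledHermite (1 / n) n).eval (z / a)‖) atTop
      (𝓝 (Real.log √‖t‖ + Psi (z / a))) := by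
    refine (hlim.const_add (Real.log √‖t‖)).congr' ?_
    filter_upwards [eventually_gt_atTop 0] with n hn
    have hn' : (n : ℝ) ≠ 0 := by exact_mod_cast hn.ne'
    rw [norm_mul, norm_pow, Real.log_mul (pow_ne_zero _ (norm_ne_zero_iff.2 ha0))
      (norm_ne_zero_iff.2 (h0 n)), Real.log_pow, hna]
    field_simp
  have hc : Tendsto (fun n : ℕ => (1 / (n : ℝ)) * Real.log ‖(r : ℂ) ^ n‖) atTop
      (𝓝 (Real.log r)) := by
    refine tendsto_const_nhds.congr' ?_
    filter_upwards [eventually_gt_atTop 0] with n hn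
    have hn' : (n : ℝ) ≠ 0 := by exact_mod_cast hn.ne'
    rw [norm_pow, Complex.norm_real, Real.norm_eq_abs, abs_of_pos hr, Real.log_pow]
    field_simp
  have hr0 : (r : ℂ) ≠ 0 := by exact_mod_cast hr.ne'
  have h := tendsto_log_norm_sub_max (fun n => mul_ne_zero (pow_ne_zero n ha0) (h0 n))
    (fun n => pow_ne_zero n hr0) hy hc (fun h => hz2 (by linarith))
  have hmax : max (Real.log √‖t‖ + Psi (z / a)) (Real.log r) =
      Real.log √‖t‖ + potential r t z := by
    rw [potential, ← ha, Real.log_div hr.ne' hpos.ne', ← max_add_add_left]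
    congr 1
    ring
  rw [hmax] at h
  simpa only [eval_evolvedPoly r ha0 (cpow_half_sq t)] using h

end Growth

/-! ### From almost everywhere convergence to convergence of integrals -/

section Vitali

/-- Convergence almost everywhere together with an `L²` bound gives convergence of integrals
against bounded functions. -/
lemma tendsto_integral_mul_of_sq_bound {α : Type*} [MeasurableSpace α] {m : Measure α}
    [IsFiniteMeasure m] {d : ℕ → α → ℝ} {ψ : α → ℝ} {C B : ℝ}
    (hψ : ∀ x, |ψ x| ≤ C) (hdm : ∀ n, Measurable (d n))
    (hlim : ∀ᵐ x ∂m, Tendsto (fun n => d n x) atTop (𝓝 0))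
    (hint : ∀ᶠ n in atTop, Integrable (fun x => d n x ^ 2) m)
    (hB : ∀ᶠ n in atTop, ∫ x, d n x ^ 2 ∂m ≤ B) :
    Tendsto (fun n => ∫ x, d n x * ψ x ∂m) atTop (𝓝 0) := by
  rw [Metric.tendsto_atTop']
  intro ε hε
  rcases isEmpty_or_nonempty α with hα | ⟨⟨x₀⟩⟩
  · exact ⟨0, fun n _ => by simpa [Measure.eq_zero_of_isEmpty m] using hε⟩
  have hC0 : 0 ≤ C := (abs_nonneg _).trans (hψ x₀)
  -- Truncation level for the splitting `|d| ≤ min |d| M + d² / M`. The first part tends to `0` in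
  -- integral by dominated convergence, and the second costs at most `|B| / M`. The `+ 1` keeps `M`
  -- positive when `C * |B| = 0`.
  obtain ⟨M, hM0, hM⟩ : ∃ M : ℝ, 0 < M ∧ C * (|B| / M) < ε / 2 := by
    refine ⟨2 * (C * |B|) / ε + 1, by positivity, ?_⟩
    have h0 : 0 ≤ C * |B| := by positivity
    rw [← mul_div_assoc, div_lt_iff₀ (by positivity)]
    have : ε / 2 * (2 * (C * |B|) / ε + 1) = C * |B| + ε / 2 := by field_simp
    linarith
  have hmin : Tendsto (fun n => ∫ x, min |d n x| M ∂m) atTop (𝓝 0) := by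
    have := tendsto_integral_of_dominated_convergence (μ := m) (F := fun n x => min |d n x| M)
      (f := fun _ => 0) (fun _ => M) (fun n =>
        (((hdm n).abs).min measurable_const).aestronglyMeasurable) (integrable_const M)
      (fun n => Eventually.of_forall fun x => by
        rw [Real.norm_of_nonneg (le_min (abs_nonneg _) hM0.le)]
        exact min_le_right _ _) ?_
    · simpa using this
    · filter_upwards [hlim] with x hx
      have := hx.abs.min (tendsto_const_nhds (x := M))
      simpa [hM0.le] using this
  have hsmall : ∀ᶠ n in atTop, C * ∫ x, min |d n x| M ∂m < ε / 2 := by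
    have := hmin.const_mul C
    rw [mul_zero] at this
    exact this.eventually_lt_const (by positivity)
  obtain ⟨N, hN⟩ := eventually_atTop.1 (hsmall.and (hint.and hB))
  refine ⟨N, fun n hn => ?_⟩
  obtain ⟨h1, h2, h3⟩ := hN n hn.le
  have hle : ∀ x, |d n x| ≤ min |d n x| M + d n x ^ 2 / M := by
    intro x
    rcases le_total |d n x| M with h | h
    · rw [min_eq_left h]
      have : 0 ≤ d n x ^ 2 / M := by positivity
      linarith
    · rw [min_eq_right h]
      have : |d n x| ≤ d n x ^ 2 / M := by
        rw [le_div_iff₀ hM0, ← sq_abs]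
        nlinarith [abs_nonneg (d n x)]
      linarith
  have hmini : Integrable (fun x => min |d n x| M) m :=
    Integrable.mono' (integrable_const M)
      (((hdm n).abs).min measurable_const).aestronglyMeasurable
      (Eventually.of_forall fun x => by
        rw [Real.norm_of_nonneg (le_min (abs_nonneg _) hM0.le)]
        exact min_le_right _ _)
  rw [dist_zero_right]
  calc ‖∫ x, d n x * ψ x ∂m‖ ≤ ∫ x, C * (min |d n x| M + d n x ^ 2 / M) ∂m := by
        refine norm_integral_le_of_norm_le ((hmini.add (h2.div_const M)).const_mul C)
          (Eventually.of_forall fun x => ?_)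
        rw [norm_mul, mul_comm]
        exact mul_le_mul (hψ x) (hle x) (abs_nonneg _) hC0
    _ = C * ∫ x, min |d n x| M ∂m + C * ((∫ x, d n x ^ 2 ∂m) / M) := by
        rw [integral_const_mul, integral_add hmini (h2.div_const M), integral_div, mul_add]
    _ ≤ C * ∫ x, min |d n x| M ∂m + C * (|B| / M) := by
        gcongr
        exact h3.trans (le_abs_self B)
    _ < ε := by linarith

end Vitali

/-- The logarithmic potential of the zero distribution of `P`. -/
noncomputable def zeroPotential (P : Polynomial ℂ) (z : ℂ) : ℝ :=
  (1 / (P.natDegree : ℝ)) * (P.roots.map fun ζ => Real.log ‖z - ζ‖).sum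

section ZeroPotential

variable {P : Polynomial ℂ} {n : ℕ} {ζ : Fin n → ℂ}

lemma zeroPotential_eq_sum (hn : P.natDegree = n) (hζ : P.roots = Finset.univ.val.map ζ) (z : ℂ) :
    zeroPotential P z = (1 / (n : ℝ)) * ∑ i, Real.log ‖z - ζ i‖ := by
  rw [zeroPotential, hζ, hn, Multiset.map_map]
  rfl

lemma measurable_zeroPotential (P : Polynomial ℂ) : Measurable (zeroPotential P) := by
  have h : ∀ s : Multiset ℂ, Measurable fun z => (s.map fun ζ => Real.log ‖z - ζ‖).sum := by
    intro s
    induction s using Multiset.induction with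
    | empty => simp
    | cons ζ s ih =>
      simp only [Multiset.map_cons, Multiset.sum_cons]
      exact (Real.measurable_log.comp (by fun_prop)).add ih
  exact (h P.roots).const_mul _

/-- Zeros must be avoided because of the convention `Real.log 0 = 0`, which breaks additivity of the
logarithm there. -/
lemma zeroPotential_eq_log (hn : P.natDegree = n) (hζ : P.roots = Finset.univ.val.map ζ)
    (hev : ∀ z, P.eval z = ∏ i, (z - ζ i)) {z : ℂ} (hz : P.eval z ≠ 0) :
    zeroPotential P z = (1 / (n : ℝ)) * Real.log ‖P.eval z‖ := by
  have h0 : ∀ i, z - ζ i ≠ 0 := fun i h => hz (by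
    rw [hev]
    exact Finset.prod_eq_zero (Finset.mem_univ i) h)
  rw [zeroPotential_eq_sum hn hζ, hev, norm_prod,
    Real.log_prod fun i _ => norm_ne_zero_iff.2 (h0 i)]

lemma integral_zeroPotential_mul_laplacian (hn : P.natDegree = n)
    (hζ : P.roots = Finset.univ.val.map ζ) {φ : ℂ → ℝ} (hφ : ContDiff ℝ ∞ φ)
    (hc : HasCompactSupport φ) :
    ∫ z, zeroPotential P z * Laplacian.laplacian φ z =
      2 * Real.pi * ∫ x, φ x ∂(zeroDistribution P : Measure ℂ) := by
  have h1 : ∀ z, zeroPotential P z * Laplacian.laplacian φ z =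
      ∑ i, (1 / (n : ℝ)) * (Real.log ‖z - ζ i‖ * Laplacian.laplacian φ z) := by
    intro z
    rw [zeroPotential_eq_sum hn hζ, Finset.mul_sum, Finset.sum_mul]
    exact Finset.sum_congr rfl fun i _ => by ring
  have hint : ∀ i, Integrable (fun z => Real.log ‖z - ζ i‖ * Laplacian.laplacian φ z) := by
    intro i
    obtain ⟨B, hB⟩ := exists_integrable_log_mul_bound (continuous_laplacian hφ)
      (hasCompactSupport_laplacian hc) ‖ζ i‖
    exact (hB (ζ i) le_rfl).1
  simp only [h1]
  rw [integral_finsetSum _ fun i _ => (hint i).const_mul _, integral_zeroDistribution hn hζ]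
  simp only [integral_const_mul, integral_log_norm_sub_mul_laplacian hφ hc]
  rw [Finset.mul_sum, Finset.mul_sum]
  exact Finset.sum_congr rfl fun i _ => by ring

/-- Cauchy–Schwarz bounds the square of an average by the average of squares, so the estimate for a
single pole passes to the potential uniformly in the degree. -/
lemma integrableOn_sq_zeroPotential (hn : P.natDegree = n) (hn1 : 1 ≤ n)
    (hζ : P.roots = Finset.univ.val.map ζ) {R S : ℝ} (hR : ∀ i, ‖ζ i‖ ≤ R) :
    IntegrableOn (fun z => zeroPotential P z ^ 2) (Metric.ball 0 S) ∧
      ∫ z in Metric.ball 0 S, zeroPotential P z ^ 2 ≤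
        ∫ z in Metric.ball (0 : ℂ) (R + S), Real.log ‖z‖ ^ 2 := by
  have hn0 : (0 : ℝ) < n := by exact_mod_cast hn1
  have h1 : ∀ z, zeroPotential P z ^ 2 ≤ ∑ i, (1 / (n : ℝ)) * Real.log ‖z - ζ i‖ ^ 2 := by
    intro z
    have h := sq_sum_le_card_mul_sum_sq (s := Finset.univ) (f := fun i => Real.log ‖z - ζ i‖)
    rw [Finset.card_univ, Fintype.card_fin] at h
    rw [zeroPotential_eq_sum hn hζ, mul_pow, ← Finset.mul_sum]
    calc (1 / (n : ℝ)) ^ 2 * (∑ i, Real.log ‖z - ζ i‖) ^ 2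
        ≤ (1 / (n : ℝ)) ^ 2 * (n * ∑ i, Real.log ‖z - ζ i‖ ^ 2) := by gcongr
      _ = 1 / (n : ℝ) * ∑ i, Real.log ‖z - ζ i‖ ^ 2 := by field_simp
  have h2 : ∀ i, IntegrableOn (fun z => (1 / (n : ℝ)) * Real.log ‖z - ζ i‖ ^ 2)
      (Metric.ball 0 S) := fun i => (integrableOn_sq_log_norm_sub (hR i)).1.const_mul _
  have h3 : IntegrableOn (fun z => ∑ i, (1 / (n : ℝ)) * Real.log ‖z - ζ i‖ ^ 2)
      (Metric.ball 0 S) := integrable_finsetSum _ fun i _ => h2 i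
  have h4 : IntegrableOn (fun z => zeroPotential P z ^ 2) (Metric.ball 0 S) :=
    Integrable.mono' h3 ((measurable_zeroPotential P).pow_const 2).aestronglyMeasurable
      (Eventually.of_forall fun z => by
        rw [Real.norm_of_nonneg (sq_nonneg _)]
        exact h1 z)
  refine ⟨h4, (integral_mono h4 h3 h1).trans ?_⟩
  rw [integral_finsetSum _ fun i _ => h2 i]
  simp only [integral_const_mul]
  rw [← Finset.mul_sum]
  calc 1 / (n : ℝ) * ∑ i, ∫ z in Metric.ball 0 S, Real.log ‖z - ζ i‖ ^ 2
      ≤ 1 / (n : ℝ) * ∑ _i : Fin n,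
        ∫ z in Metric.ball (0 : ℂ) (R + S), Real.log ‖z‖ ^ 2 := by
        gcongr with i
        exact (integrableOn_sq_log_norm_sub (hR i)).2
    _ = _ := by
        rw [Finset.sum_const, Finset.card_univ, Fintype.card_fin, nsmul_eq_mul]
        field_simp

end ZeroPotential

/-- The zero distributions converge against test functions to the distributional Laplacian of the
potential. -/
lemma tendsto_integral_zeroDistribution {r : ℝ} (hr : 0 < r) {t : ℂ} (ht : t ≠ 0) {φ : ℂ → ℝ}
    (hφ : ContDiff ℝ ∞ φ) (hc : HasCompactSupport φ) :
    Tendsto (fun n => ∫ x, φ x ∂(zeroDistribution (evolvedPoly r t n) : Measure ℂ)) atTop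
      (𝓝 ((1 / (2 * Real.pi)) * ∫ z, potential r t z * Laplacian.laplacian φ z)) := by
  set ψ := Laplacian.laplacian φ with hψdef
  have hψ : Continuous ψ := continuous_laplacian hφ
  have hψc : HasCompactSupport ψ := hasCompactSupport_laplacian hc
  obtain ⟨S, C, hC0, hC⟩ := exists_bound_of_hasCompactSupport hψ hψc
  have hψC : ∀ z, |ψ z| ≤ C := fun z => (hC z).trans (indicator_le_self' (fun _ _ => hC0) z)
  have hψS : ∀ z, z ∉ Metric.ball (0 : ℂ) S → ψ z = 0 := fun z hz => by
    have := hC z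
    rw [indicator_of_notMem hz] at this
    exact abs_eq_zero.1 (le_antisymm this (abs_nonneg _))
  set R := max (2 * √‖t‖) (2 * r) with hR
  set u : ℂ → ℝ := fun z => Real.log √‖t‖ + potential r t z with hu
  have huc : Continuous u := continuous_const.add (continuous_potential r t)
  set d : ℕ → ℂ → ℝ := fun n z => zeroPotential (evolvedPoly r t n) z - u z with hd
  set m : Measure ℂ := volume.restrict (Metric.ball 0 S) with hm
  have hfin : IsFiniteMeasure m := by
    refine isFiniteMeasure_restrict.2 ?_
    exact measure_ball_lt_top.ne
  have hu2 : Integrable (fun z => u z ^ 2) m :=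
    ((huc.pow 2).continuousOn.integrableOn_compact (isCompact_closedBall (0 : ℂ) S)).mono_set
      Metric.ball_subset_closedBall
  have hlim : ∀ᵐ z ∂m, Tendsto (fun n => d n z) atTop (𝓝 0) := by
    refine ae_restrict_of_ae ?_
    filter_upwards [ae_tendsto_log_evolvedPoly hr ht] with z hz
    have h1 : Tendsto (fun n => zeroPotential (evolvedPoly r t n) z) atTop (𝓝 (u z)) := by
      refine hz.2.congr' ?_
      filter_upwards [hz.1, eventually_ge_atTop 1] with n hn hn1
      obtain ⟨hmon, hdeg⟩ := evolvedPoly_monic_natDegree r t hn1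
      obtain ⟨ζ, hζ, hev, -⟩ := exists_fin_roots hmon hdeg
      exact (zeroPotential_eq_log hdeg hζ hev hn).symm
    simpa [hd] using h1.sub_const (u z)
  have hL2 : ∀ᶠ n in atTop, Integrable (fun z => d n z ^ 2) m ∧ ∫ z, d n z ^ 2 ∂m ≤
      2 * (∫ z in Metric.ball (0 : ℂ) (R + S), Real.log ‖z‖ ^ 2) + 2 * ∫ z, u z ^ 2 ∂m := by
    filter_upwards [eventually_ge_atTop 1] with n hn1
    obtain ⟨hmon, hdeg⟩ := evolvedPoly_monic_natDegree r t hn1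
    obtain ⟨ζ, hζ, hev, h0⟩ := exists_fin_roots hmon hdeg
    obtain ⟨h1, h2⟩ := integrableOn_sq_zeroPotential (S := S) hdeg hn1 hζ
      fun i => norm_le_of_isRoot_evolvedPoly hr ht hn1 (h0 i)
    have h3 : Integrable (fun z => 2 * zeroPotential (evolvedPoly r t n) z ^ 2 + 2 * u z ^ 2) m :=
      (h1.const_mul 2).add (hu2.const_mul 2)
    have h4 : ∀ z, d n z ^ 2 ≤ 2 * zeroPotential (evolvedPoly r t n) z ^ 2 + 2 * u z ^ 2 := by
      intro z
      simp only [hd]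
      nlinarith [sq_nonneg (zeroPotential (evolvedPoly r t n) z + u z)]
    have h5 : Integrable (fun z => d n z ^ 2) m :=
      h3.mono' (((measurable_zeroPotential _).sub huc.measurable).pow_const 2).aestronglyMeasurable
        (Eventually.of_forall fun z => by
          rw [Real.norm_of_nonneg (sq_nonneg _)]
          exact h4 z)
    refine ⟨h5, (integral_mono h5 h3 h4).trans ?_⟩
    rw [integral_add (h1.const_mul 2) (hu2.const_mul 2), integral_const_mul, integral_const_mul]
    gcongr
  have hmain := tendsto_integral_mul_of_sq_bound hψC
    (fun n => (measurable_zeroPotential _).sub huc.measurable) hlim (hL2.mono fun _ h => h.1)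
    (hL2.mono fun _ h => h.2)
  -- The constant `log √|t|` disappears because the Laplacian of a test function has integral zero.
  have hint_u : ∫ z, u z * ψ z = ∫ z, potential r t z * ψ z := by
    have h1 : Integrable (fun z => Real.log √‖t‖ * ψ z) :=
      (hψ.integrable_of_hasCompactSupport hψc).const_mul _
    have h2 : Integrable (fun z => potential r t z * ψ z) :=
      ((continuous_potential r t).mul hψ).integrable_of_hasCompactSupport hψc.mul_left
    simp only [hu, add_mul]
    rw [integral_add h1 h2, integral_const_mul, integral_laplacian_eq_zero hφ hc, mul_zero,
      zero_add]
  have heq : ∀ᶠ n in atTop, (1 / (2 * Real.pi)) * (∫ z, d n z * ψ z ∂m) +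
      (1 / (2 * Real.pi)) * ∫ z, potential r t z * ψ z =
      ∫ x, φ x ∂(zeroDistribution (evolvedPoly r t n) : Measure ℂ) := by
    filter_upwards [eventually_ge_atTop 1] with n hn1
    obtain ⟨hmon, hdeg⟩ := evolvedPoly_monic_natDegree r t hn1
    obtain ⟨ζ, hζ, hev, h0⟩ := exists_fin_roots hmon hdeg
    have h1 : Integrable (fun z => zeroPotential (evolvedPoly r t n) z * ψ z) := by
      have h2 : ∀ z, zeroPotential (evolvedPoly r t n) z * ψ z =
          ∑ i, (1 / (n : ℝ)) * (Real.log ‖z - ζ i‖ * ψ z) := by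
        intro z
        rw [zeroPotential_eq_sum hdeg hζ, Finset.mul_sum, Finset.sum_mul]
        exact Finset.sum_congr rfl fun i _ => by ring
      simp only [h2]
      refine integrable_finsetSum _ fun i _ => Integrable.const_mul ?_ _
      obtain ⟨B, hB⟩ := exists_integrable_log_mul_bound hψ hψc ‖ζ i‖
      exact (hB (ζ i) le_rfl).1
    have h2 : Integrable (fun z => u z * ψ z) :=
      (huc.mul hψ).integrable_of_hasCompactSupport hψc.mul_left
    have h3 : ∫ z, d n z * ψ z ∂m = ∫ z, d n z * ψ z := by
      refine setIntegral_eq_integral_of_forall_compl_eq_zero fun z hz => ?_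
      rw [hψS z hz, mul_zero]
    have h4 : ∫ z, d n z * ψ z = (∫ z, zeroPotential (evolvedPoly r t n) z * ψ z) -
        ∫ z, potential r t z * ψ z := by
      rw [← hint_u, ← integral_sub h1 h2]
      simp only [hd, sub_mul]
    rw [h3, h4, integral_zeroPotential_mul_laplacian hdeg hζ hφ hc]
    have := Real.pi_ne_zero
    field_simp
    ring
  have hfinal := (hmain.const_mul (1 / (2 * Real.pi))).add_const
    ((1 / (2 * Real.pi)) * ∫ z, potential r t z * ψ z)
  rw [mul_zero, zero_add] at hfinal
  exact hfinal.congr' heq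

/-! ### Uniqueness of the Riesz measure -/

/-- Compactly supported continuous functions determine the measure. Each is a uniform limit of
smooth functions supported inside its own support, a compact set of finite mass for both measures.
-/
theorem ext_of_integral_testFunction_eq {m m' : Measure ℂ} [IsLocallyFiniteMeasure m]
    [IsLocallyFiniteMeasure m']
    (h : ∀ φ : ℂ → ℝ, ContDiff ℝ ∞ φ → HasCompactSupport φ → ∫ z, φ z ∂m = ∫ z, φ z ∂m') :
    m = m' := by
  refine Measure.ext_of_integral_eq_on_compactlySupported fun f => ?_
  set K := tsupport f with hK
  have hKc : IsCompact K := f.hasCompactSupport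
  have approx : ∀ (ρ : Measure ℂ) [IsLocallyFiniteMeasure ρ] (g : ℂ → ℝ) (ε : ℝ),
      Continuous g → Function.support g ⊆ Function.support f → (∀ z, dist (g z) (f z) < ε) →
      |∫ z, g z ∂ρ - ∫ z, f z ∂ρ| ≤ ε * ρ.real K := by
    intro ρ _ g ε hg hs hd
    have hgK : tsupport g ⊆ K := closure_mono hs
    have hgc : HasCompactSupport g := hKc.of_isClosed_subset (isClosed_tsupport g) hgK
    have hfi : Integrable (fun z => f z) ρ :=
      f.continuous.integrable_of_hasCompactSupport f.hasCompactSupport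
    rw [← integral_sub (hg.integrable_of_hasCompactSupport hgc) hfi]
    rw [← setIntegral_eq_integral_of_forall_compl_eq_zero (s := K) (fun z hz => by
      rw [image_eq_zero_of_notMem_tsupport hz,
        image_eq_zero_of_notMem_tsupport (fun h => hz (hgK h)), sub_zero])]
    rw [← Real.norm_eq_abs]
    exact norm_setIntegral_le_of_norm_le_const hKc.measure_lt_top
      (fun z _ => (dist_eq_norm (g z) (f z)).symm.le.trans (hd z).le)
  by_contra hne
  set A := |∫ z, f z ∂m - ∫ z, f z ∂m'| with hA
  have hApos : 0 < A := abs_pos.2 (sub_ne_zero.2 hne)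
  set S := m.real K + m'.real K + 1 with hS
  have hSpos : 0 < S := by positivity
  -- With this accuracy the two errors add up to at most `A / 2`, contradicting that the integrals
  -- differ by `A > 0`.
  obtain ⟨g, hg, hd, hs⟩ := Continuous.exists_contDiff_approx (ε := fun _ => A / (2 * S)) ⊤
    f.continuous continuous_const (fun _ => by positivity)
  have hgc : HasCompactSupport g :=
    hKc.of_isClosed_subset (isClosed_tsupport g) (closure_mono hs)
  have h1 := approx m g _ hg.continuous hs hd
  have h2 := approx m' g _ hg.continuous hs hd
  rw [h g hg hgc] at h1
  have h3 : A ≤ A / (2 * S) * m.real K + A / (2 * S) * m'.real K := by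
    refine le_trans ?_ (add_le_add h1 h2)
    rw [hA, abs_sub_comm (∫ z, g z ∂m') (∫ z, f z ∂m)]
    exact abs_sub_le _ _ _
  have h4 : A / (2 * S) * m.real K + A / (2 * S) * m'.real K ≤ A / (2 * S) * S := by
    rw [← mul_add]
    exact mul_le_mul_of_nonneg_left (by linarith) (by positivity)
  have h5 : A / (2 * S) * S = A / 2 := by field_simp
  linarith

theorem IsRieszMeasure.unique {u : ℂ → ℝ} {m m' : Measure ℂ} (h : IsRieszMeasure u m)
    (h' : IsRieszMeasure u m') : m = m' := by
  have := h.locallyFinite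
  have := h'.locallyFinite
  exact ext_of_integral_testFunction_eq fun φ hφ hc => by
    rw [h.integral_eq φ hφ hc, h'.integral_eq φ hφ hc]

/-! ### Existence of the limit measure -/

/-- Along an ultrafilter realising the cluster point, test-function integrals converge both to those
of `ν` and to the limit for the full sequence. Total mass is weakly continuous, so none is lost. -/
theorem isRieszMeasure_of_mapClusterPt {r : ℝ} (hr : 0 < r) {t : ℂ} (ht : t ≠ 0)
    {ν : FiniteMeasure ℂ}
    (hν : MapClusterPt ν atTop (fun n => zeroDistribution (evolvedPoly r t n))) :
    IsRieszMeasure (potential r t) (ν : Measure ℂ) ∧ IsProbabilityMeasure (ν : Measure ℂ) := by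
  obtain ⟨U, hU, hlim⟩ := mapClusterPt_iff_ultrafilter.1 hν
  refine ⟨⟨(continuous_potential r t).locallyIntegrable, inferInstance, fun φ hφ hc => ?_⟩, ?_⟩
  · obtain ⟨C, hC⟩ := hc.exists_bound_of_continuous hφ.continuous
    have h1 := FiniteMeasure.tendsto_iff_forall_integral_tendsto.1 hlim
      (BoundedContinuousFunction.ofNormedAddCommGroup φ hφ.continuous C hC)
    exact tendsto_nhds_unique h1 ((tendsto_integral_zeroDistribution hr ht hφ hc).mono_left hU)
  · have h1 := hlim.mass
    have h2 : ∀ᶠ n in (U : Filter ℕ), (zeroDistribution (evolvedPoly r t n)).mass = 1 := by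
      filter_upwards [hU (eventually_ge_atTop 1)] with n hn
      have := isProbabilityMeasure_zeroDistribution_evolvedPoly r t hn
      rw [FiniteMeasure.mass, FiniteMeasure.coeFn_def]
      simp
    have h3 : ν.mass = 1 := tendsto_nhds_unique (h1.congr' h2) tendsto_const_nhds
    refine ⟨?_⟩
    rw [← FiniteMeasure.ennreal_mass, h3, ENNReal.coe_one]

/-- The zero distributions eventually lie in a weakly compact set of measures carried by one disc. A
cluster point exists, uniqueness of the Riesz measure makes it the only one, and hence the whole
sequence converges. -/
theorem exists_limit_zeroDistribution {r : ℝ} (hr : 0 < r) {t : ℂ} (ht : t ≠ 0) :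
    ∃ μ : ProbabilityMeasure ℂ, IsRieszMeasure (potential r t) (μ : Measure ℂ) ∧
      Tendsto (fun n => zeroDistribution (evolvedPoly r t n)) atTop (𝓝 μ.toFiniteMeasure) := by
  have hcomp := isCompact_setOfPred_finiteMeasure_le_of_isCompact 1
    (isCompact_closedBall (0 : ℂ) (max (2 * √‖t‖) (2 * r)))
  have hmem : ∀ᶠ n in atTop, zeroDistribution (evolvedPoly r t n) ∈
      {μ : FiniteMeasure ℂ | μ.mass ≤ 1 ∧
        μ (Metric.closedBall (0 : ℂ) (max (2 * √‖t‖) (2 * r)))ᶜ = 0} := by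
    filter_upwards [eventually_ge_atTop 1] with n hn
    have := isProbabilityMeasure_zeroDistribution_evolvedPoly r t hn
    refine ⟨?_, ?_⟩
    · rw [FiniteMeasure.mass, FiniteMeasure.coeFn_def]
      simp
    · rw [FiniteMeasure.null_iff_toMeasure_null]
      exact zeroDistribution_compl_closedBall hr ht hn
  obtain ⟨ν, -, hν⟩ := hcomp.exists_mapClusterPt_of_frequently hmem.frequently
  obtain ⟨h1, h2⟩ := isRieszMeasure_of_mapClusterPt hr ht hν
  refine ⟨⟨(ν : Measure ℂ), h2⟩, h1, ?_⟩
  refine hcomp.le_nhds_of_unique_clusterPt hmem fun ρ _ hρ => ?_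
  exact Subtype.ext ((isRieszMeasure_of_mapClusterPt hr ht hρ).1.unique h1)

/-! ### The support -/

/-- Test against a nonnegative bump equal to `1` at `z₀`. Its integral is zero, so its positivity
set is a null neighbourhood. -/
theorem IsRieszMeasure.notMem_support {u : ℂ → ℝ} {m : Measure ℂ} (h : IsRieszMeasure u m)
    {z₀ : ℂ} {W : Set ℂ} (hW : W ∈ 𝓝 z₀)
    (hzero : ∀ φ : ℂ → ℝ, ContDiff ℝ ∞ φ → HasCompactSupport φ → tsupport φ ⊆ W →
      ∫ z, u z * Laplacian.laplacian φ z = 0) :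
    z₀ ∉ m.support := by
  have := h.locallyFinite
  obtain ⟨φ, hφW, hc, hφ, hrange, hφ1⟩ := exists_contDiff_tsupport_subset (n := ⊤) hW
  have hnonneg : ∀ z, 0 ≤ φ z := fun z => (hrange (mem_range_self z)).1
  have hint : ∫ z, φ z ∂m = 0 := by
    rw [h.integral_eq φ hφ hc, hzero φ hφ hc hφW, mul_zero]
  rw [integral_eq_zero_iff_of_nonneg hnonneg
    (hφ.continuous.integrable_of_hasCompactSupport hc)] at hint
  rw [Measure.notMem_support_iff_exists]
  refine ⟨{z | 0 < φ z}, (isOpen_lt continuous_const hφ.continuous).mem_nhds ?_, ?_⟩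
  · simp [hφ1]
  · refine measure_mono_null (fun z hz => ?_) hint
    exact ne_of_gt hz

theorem potential_ofReal {r t : ℝ} (ht : 0 < t) (z : ℂ) :
    potential r (t : ℂ) z = max (Psi (z / ((√t : ℝ) : ℂ))) (Real.log (r / √t)) := by
  rw [potential, ofReal_cpow_half ht.le, Complex.norm_real, Real.norm_of_nonneg ht.le]

theorem notMem_support_of_Psi_lt {r t : ℝ} (ht : 0 < t) {m : Measure ℂ}
    (h : IsRieszMeasure (potential r (t : ℂ)) m) {z₀ : ℂ}
    (hz : Psi (z₀ / ((√t : ℝ) : ℂ)) < Real.log (r / √t)) : z₀ ∉ m.support := by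
  have hcont : Continuous fun z : ℂ => Psi (z / ((√t : ℝ) : ℂ)) :=
    continuous_Psi.comp (continuous_id.div_const _)
  refine h.notMem_support ((isOpen_lt hcont continuous_const).mem_nhds hz) fun φ hφ hc hs => ?_
  have heq : ∀ z, potential r (t : ℂ) z * Laplacian.laplacian φ z =
      Real.log (r / √t) * Laplacian.laplacian φ z := fun z => by
    by_cases hzs : z ∈ tsupport φ
    · rw [potential_ofReal ht, max_eq_right (le_of_lt (hs hzs))]
    · rw [image_eq_zero_of_notMem_tsupport fun h' => hzs (tsupport_laplacian_subset φ h')]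
      simp
  simp_rw [heq]
  rw [integral_const_mul, integral_laplacian_eq_zero hφ hc, mul_zero]

/-- Near such a point the potential coincides with `Psi (z / √t)`, whose Riesz measure is the
semicircle law, carried by the segment. -/
theorem notMem_support_of_lt_Psi {r t : ℝ} (ht : 0 < t) {m : Measure ℂ}
    (h : IsRieszMeasure (potential r (t : ℂ)) m) {z₀ : ℂ}
    (hz : Real.log (r / √t) < Psi (z₀ / ((√t : ℝ) : ℂ)))
    (hseg : z₀ ∉ realSegment (-(2 * √t)) (2 * √t)) : z₀ ∉ m.support := by
  have hcont : Continuous fun z : ℂ => Psi (z / ((√t : ℝ) : ℂ)) :=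
    continuous_Psi.comp (continuous_id.div_const _)
  refine h.notMem_support (inter_mem ((isOpen_lt continuous_const hcont).mem_nhds hz)
    ((isClosed_realSegment _ _).isOpen_compl.mem_nhds hseg)) fun φ hφ hc hs => ?_
  have heq : ∀ z, potential r (t : ℂ) z * Laplacian.laplacian φ z =
      Psi (z / ((√t : ℝ) : ℂ)) * Laplacian.laplacian φ z := fun z => by
    by_cases hzs : z ∈ tsupport φ
    · rw [potential_ofReal ht, max_eq_left (le_of_lt (hs hzs).1)]
    · rw [image_eq_zero_of_notMem_tsupport fun h' => hzs (tsupport_laplacian_subset φ h')]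
      simp
  simp_rw [heq]
  rw [integral_Psi_mul_laplacian ht hφ hc, integral_eq_zero_of_ae, mul_zero]
  filter_upwards [ae_mem_realSegment_semicircle t] with x hx
  exact image_eq_zero_of_notMem_tsupport fun hxs => (hs hxs).2 hx

theorem mem_levelSet_or_of_mem_support {r t : ℝ} (ht : 0 < t) {m : Measure ℂ}
    (h : IsRieszMeasure (potential r (t : ℂ)) m) {z : ℂ} (hz : z ∈ m.support) :
    z ∈ levelSet r t ∨ (z ∈ realSegment (-(2 * √t)) (2 * √t) ∧
      Real.log (r / √t) < Psi (z / ((√t : ℝ) : ℂ))) := by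
  rcases lt_trichotomy (Psi (z / ((√t : ℝ) : ℂ))) (Real.log (r / √t)) with h1 | h1 | h1
  · exact absurd hz (notMem_support_of_Psi_lt ht h h1)
  · exact Or.inl h1
  · refine Or.inr ⟨?_, h1⟩
    by_contra h2
    exact notMem_support_of_lt_Psi ht h h1 h2 hz

theorem Psi_ofReal_div_sqrt {t x : ℝ} (ht : 0 < t) (hx : |x| ≤ 2 * √t) :
    Psi ((x : ℂ) / ((√t : ℝ) : ℂ)) = x ^ 2 / (4 * t) - 1 / 2 := by
  have hs : 0 < √t := Real.sqrt_pos.2 ht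
  rw [← Complex.ofReal_div, Psi_ofReal, div_pow, Real.sq_sqrt ht.le]
  · field_simp
  · rwa [abs_div, abs_of_pos hs, div_le_iff₀ hs]

/-- This form shares the `-1/2` with `Psi (x / √t) = x² / (4t) - 1/2`, so comparing the two becomes
comparing `x²` with `2t log (r² e / t)`. -/
theorem log_div_sqrt {r t : ℝ} (hr : 0 < r) (ht : 0 < t) :
    Real.log (r / √t) = Real.log (r ^ 2 * Real.exp 1 / t) / 2 - 1 / 2 := by
  rw [Real.log_div hr.ne' (Real.sqrt_pos.2 ht).ne', Real.log_sqrt ht.le,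
    Real.log_div (by positivity) ht.ne', Real.log_mul (by positivity) (Real.exp_pos 1).ne',
    Real.log_pow, Real.log_exp]
  push_cast
  ring

/-- On the segment `Psi ≤ 1/2`, and `t ≤ r² / e` means `log (r / √t) ≥ 1/2`, so `Psi` never
dominates strictly there. -/
theorem support_subset_levelSet {r t : ℝ} (hr : 0 < r) (ht : 0 < t)
    (htr : t ≤ r ^ 2 / Real.exp 1) {m : Measure ℂ}
    (h : IsRieszMeasure (potential r (t : ℂ)) m) : m.support ⊆ levelSet r t := by
  intro z hz
  refine (mem_levelSet_or_of_mem_support ht h hz).resolve_right ?_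
  rintro ⟨⟨x, hx, rfl⟩, hlt⟩
  have hx' : |x| ≤ 2 * √t := abs_le.2 hx
  rw [Psi_ofReal_div_sqrt ht hx', log_div_sqrt hr ht] at hlt
  have h1 : x ^ 2 / (4 * t) ≤ 1 := by
    rw [div_le_one (by positivity)]
    calc x ^ 2 ≤ (2 * √t) ^ 2 := sq_le_sq' hx.1 hx.2
      _ = 4 * t := by rw [mul_pow, Real.sq_sqrt ht.le]; norm_num
  have h2 : 2 ≤ Real.log (r ^ 2 * Real.exp 1 / t) := by
    rw [Real.le_log_iff_exp_le (by positivity), le_div_iff₀ ht,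
      show (2 : ℝ) = 1 + 1 by norm_num, Real.exp_add]
    rw [le_div_iff₀ (Real.exp_pos 1)] at htr
    nlinarith [Real.exp_pos 1]
  linarith

theorem sqrt_log_lt {r t : ℝ} (hr : 0 < r) (htr : r ^ 2 / Real.exp 1 < t) :
    √(2 * t * Real.log (r ^ 2 * Real.exp 1 / t)) < 2 * √t := by
  have ht : 0 < t := lt_trans (by positivity) htr
  have h2 : Real.log (r ^ 2 * Real.exp 1 / t) < 2 := by
    rw [Real.log_lt_iff_lt_exp (by positivity), div_lt_iff₀ ht,
      show (2 : ℝ) = 1 + 1 by norm_num, Real.exp_add]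
    rw [div_lt_iff₀ (Real.exp_pos 1)] at htr
    nlinarith [Real.exp_pos 1]
  rw [Real.sqrt_lt' (by positivity), mul_pow, Real.sq_sqrt ht.le]
  nlinarith

theorem support_subset_levelSet_union {r t : ℝ} (hr : 0 < r) (ht : 0 < t) {m : Measure ℂ}
    (h : IsRieszMeasure (potential r (t : ℂ)) m) :
    m.support ⊆ levelSet r t ∪
      (realSegment (√(2 * t * Real.log (r ^ 2 * Real.exp 1 / t))) (2 * √t) ∪
        realSegment (-(2 * √t)) (-√(2 * t * Real.log (r ^ 2 * Real.exp 1 / t)))) := by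
  intro z hz
  refine (mem_levelSet_or_of_mem_support ht h hz).imp_right ?_
  rintro ⟨⟨x, hx, rfl⟩, hlt⟩
  have hx' : |x| ≤ 2 * √t := abs_le.2 hx
  rw [Psi_ofReal_div_sqrt ht hx', log_div_sqrt hr ht] at hlt
  have h1 : √(2 * t * Real.log (r ^ 2 * Real.exp 1 / t)) ≤ |x| := by
    refine Real.sqrt_le_iff.2 ⟨abs_nonneg x, ?_⟩
    rw [sq_abs]
    have h2 : Real.log (r ^ 2 * Real.exp 1 / t) / 2 < x ^ 2 / (4 * t) := by linarith
    rw [lt_div_iff₀ (by positivity)] at h2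
    linarith
  rcases le_abs.1 h1 with h2 | h2
  · exact Or.inl ⟨x, ⟨h2, hx.2⟩, rfl⟩
  · exact Or.inr ⟨x, ⟨hx.1, by linarith⟩, rfl⟩

/-! ### The semicircle regime -/

/-- For `t ≥ r² e` the constant is at most `-1/2`, a global lower bound of `Psi`, so the maximum is
always `Psi`. -/
theorem isRieszMeasure_semicircle {r t : ℝ} (hr : 0 < r) (htr : r ^ 2 * Real.exp 1 ≤ t) :
    IsRieszMeasure (potential r (t : ℂ)) (semicircle t) := by
  have ht : 0 < t := lt_of_lt_of_le (by positivity) htr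
  refine ⟨(continuous_potential r t).locallyIntegrable, inferInstance, fun φ hφ hc => ?_⟩
  have hlog : Real.log (r / √t) ≤ -(1 / 2) := by
    have : Real.log (r ^ 2 * Real.exp 1 / t) ≤ 0 :=
      Real.log_nonpos (by positivity) ((div_le_one ht).2 htr)
    rw [log_div_sqrt hr ht]
    linarith
  have heq : ∀ z, potential r (t : ℂ) z = Psi (z / ((√t : ℝ) : ℂ)) := fun z => by
    rw [potential_ofReal ht, max_eq_left (hlog.trans (neg_half_le_Psi _))]
  simp_rw [heq]
  rw [integral_Psi_mul_laplacian ht hφ hc]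
  field_simp

/-! ### Rotations -/

theorem laplacian_comp_mul_right {φ : ℂ → ℝ} (hφ : ContDiff ℝ ∞ φ) (θ : ℝ) (z : ℂ) :
    Laplacian.laplacian (fun w => φ (w * unitVec θ)) z =
      Laplacian.laplacian φ (z * unitVec θ) := by
  set L : ℂ →L[ℝ] ℂ := (ContinuousLinearMap.mul ℝ ℂ).flip (unitVec θ) with hL
  have hcomp : (fun w => φ (w * unitVec θ)) = φ ∘ L := rfl
  have hLz : L z = z * unitVec θ := rfl
  rw [hcomp, InnerProductSpace.laplacian_eq_iteratedFDeriv_complexPlane,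
    laplacian_eq_unitVec φ _ θ]
  have h2 := L.iteratedFDeriv_comp_right hφ z (i := 2) (WithTop.coe_le_coe.2 le_top)
  simp only [h2, ContinuousMultilinearMap.compContinuousLinearMap_apply,
    iteratedFDeriv_two_apply, hLz]
  simp [hL, mul_comm (unitVec θ) Complex.I]

theorem potential_mul_exp {r : ℝ} {t : ℂ} {θ : ℝ} (ht : t = (‖t‖ : ℂ) * Complex.exp (Complex.I * θ))
    (z : ℂ) :
    potential r t (z * Complex.exp (Complex.I * θ / 2)) = potential r (‖t‖ : ℂ) z := by
  set e := Complex.exp (Complex.I * θ / 2) with he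
  have he0 : e ≠ 0 := Complex.exp_ne_zero _
  have he2 : e ^ 2 = Complex.exp (Complex.I * θ) := by
    rw [he, ← Complex.exp_nat_mul]
    congr 1
    push_cast
    ring
  have hsq : (t ^ (1 / 2 : ℂ)) ^ 2 = (((√‖t‖ : ℝ) : ℂ) * e) ^ 2 := by
    rw [cpow_half_sq, mul_pow, he2, ← Complex.ofReal_pow, Real.sq_sqrt (norm_nonneg t)]
    exact ht
  rw [potential, potential, ofReal_cpow_half (norm_nonneg t), Complex.norm_real, norm_norm]
  -- The principal root of `t` agrees with `√|t| exp(iθ/2)` only up to sign, as `θ` is any argument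
  -- of `t`. Evenness of `Psi` absorbs the sign.
  rcases sq_eq_sq_iff_eq_or_eq_neg.1 hsq with h | h
  · rw [h, mul_div_mul_right _ _ he0]
  · rw [h, div_neg, Psi_neg, mul_div_mul_right _ _ he0]

/-- Change variables by the rotation. Lebesgue measure and the Laplacian are invariant, and the
potential for `t` pulls back to the one for `|t|`. -/
theorem IsRieszMeasure.map_rotation {r : ℝ} {t : ℂ} {θ : ℝ}
    (ht : t = (‖t‖ : ℂ) * Complex.exp (Complex.I * θ)) {m : Measure ℂ} [IsFiniteMeasure m]
    (h : IsRieszMeasure (potential r (‖t‖ : ℂ)) m) :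
    IsRieszMeasure (potential r t)
      (m.map fun z : ℂ => z * Complex.exp (Complex.I * θ / 2)) := by
  have he : Complex.exp (Complex.I * θ / 2) = unitVec (θ / 2) := by
    rw [unitVec, Complex.ofReal_cos, Complex.ofReal_sin, ← Complex.exp_mul_I]
    congr 1
    push_cast
    ring
  have hcont : Continuous fun z : ℂ => z * unitVec (θ / 2) := continuous_mul_const _
  refine ⟨(continuous_potential r t).locallyIntegrable, inferInstance, fun φ hφ hc => ?_⟩
  have hpot := potential_mul_exp (r := r) ht
  rw [he] at hpot ⊢
  set e := unitVec (θ / 2) with hedef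
  have hnorm : ‖e‖ = 1 := norm_unitVec _
  have he0 : e ≠ 0 := norm_ne_zero_iff.1 (by rw [hnorm]; exact one_ne_zero)
  let rot : ℂ ≃ₗᵢ[ℝ] ℂ := rotation ⟨e, mem_sphere_zero_iff_norm.2 hnorm⟩
  have hrot : ∀ z, rot z = z * e := fun z => by
    rw [mul_comm]
    exact rotation_apply _ z
  rw [integral_map hcont.aemeasurable hφ.continuous.aestronglyMeasurable,
    h.integral_eq (fun z => φ (z * e)) (hφ.comp (contDiff_id.mul contDiff_const))
      (hc.comp_homeomorph (Homeomorph.mulRight₀ e he0)),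
    ← rot.measurePreserving.integral_comp rot.toHomeomorph.measurableEmbedding
      (fun z => potential r t z * Laplacian.laplacian φ z)]
  simp only [hrot, hpot]
  simp only [hedef, laplacian_comp_mul_right hφ]

end HeatFlowZeros

theorem proposition4p4 (r : ℝ) (hr : 0 < r) :
    ∃ μ : ℂ → ProbabilityMeasure ℂ,
      -- `μ t = (1 / 2π) Δ max {Ψ(z / √t), log (r / √|t|)}`, which determines `μ t`
      (∀ t : ℂ, t ≠ 0 → ∀ m : Measure ℂ,
        HeatFlowZeros.IsRieszMeasure (HeatFlowZeros.potential r t) m ↔ m = (μ t : Measure ℂ)) ∧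
      -- the zero distributions are probability measures and converge weakly to `μ t`
      (∀ t : ℂ, t ≠ 0 →
        (∀ n : ℕ, 1 ≤ n → IsProbabilityMeasure
          (HeatFlowZeros.zeroDistribution (HeatFlowZeros.evolvedPoly r t n) : Measure ℂ)) ∧
        Tendsto (fun n : ℕ => HeatFlowZeros.zeroDistribution (HeatFlowZeros.evolvedPoly r t n))
          atTop (𝓝 (μ t).toFiniteMeasure)) ∧
      -- (a)
      (∀ t : ℝ, 0 < t → t ≤ r ^ 2 / Real.exp 1 →
        (μ (t : ℂ) : Measure ℂ).support ⊆ HeatFlowZeros.levelSet r t) ∧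
      -- (b), with non-degenerate intervals
      (∀ t : ℝ, r ^ 2 / Real.exp 1 < t → t < r ^ 2 * Real.exp 1 →
        √(2 * t * Real.log (r ^ 2 * Real.exp 1 / t)) < 2 * √t ∧
        (μ (t : ℂ) : Measure ℂ).support ⊆
          HeatFlowZeros.levelSet r t ∪
            (HeatFlowZeros.realSegment
                (√(2 * t * Real.log (r ^ 2 * Real.exp 1 / t))) (2 * √t) ∪
              HeatFlowZeros.realSegment
                (-(2 * √t)) (-√(2 * t * Real.log (r ^ 2 * Real.exp 1 / t))))) ∧
      -- (c)
      (∀ t : ℝ, r ^ 2 * Real.exp 1 ≤ t →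
        (μ (t : ℂ) : Measure ℂ) = HeatFlowZeros.semicircle t) ∧
      -- (d)
      (∀ (t : ℂ) (φ : ℝ), t ≠ 0 → t = (‖t‖ : ℂ) * Complex.exp (Complex.I * φ) →
        (μ t : Measure ℂ) =
          (μ (‖t‖ : ℂ) : Measure ℂ).map (fun z : ℂ => z * Complex.exp (Complex.I * φ / 2))) := by
  classical
  have hex : ∀ t : ℂ, ∃ μ : ProbabilityMeasure ℂ, t ≠ 0 →
      HeatFlowZeros.IsRieszMeasure (HeatFlowZeros.potential r t) (μ : Measure ℂ) ∧
      Tendsto (fun n => HeatFlowZeros.zeroDistribution (HeatFlowZeros.evolvedPoly r t n))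
        atTop (𝓝 μ.toFiniteMeasure) := fun t => by
    by_cases ht : t = 0
    -- An arbitrary value at `t = 0`, where nothing is required.
    · exact ⟨diracProba 0, fun h => absurd ht h⟩
    · obtain ⟨μ, hμ⟩ := HeatFlowZeros.exists_limit_zeroDistribution hr ht
      exact ⟨μ, fun _ => hμ⟩
  choose μ hμ using hex
  have hRiesz : ∀ t : ℝ, 0 < t →
      HeatFlowZeros.IsRieszMeasure (HeatFlowZeros.potential r (t : ℂ)) (μ (t : ℂ) : Measure ℂ) :=
    fun t ht => (hμ t (Complex.ofReal_ne_zero.2 ht.ne')).1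
  refine ⟨μ, fun t ht m => ⟨fun h => h.unique (hμ t ht).1, fun h => h ▸ (hμ t ht).1⟩,
    fun t ht => ⟨fun n hn =>
      HeatFlowZeros.isProbabilityMeasure_zeroDistribution_evolvedPoly r t hn, (hμ t ht).2⟩,
    fun t ht htr => HeatFlowZeros.support_subset_levelSet hr ht htr (hRiesz t ht),
    fun t htr _ => ⟨HeatFlowZeros.sqrt_log_lt hr htr, ?_⟩, fun t htr => ?_, fun t φ ht htφ => ?_⟩
  · have ht : 0 < t := lt_trans (by positivity) htr
    exact HeatFlowZeros.support_subset_levelSet_union hr ht (hRiesz t ht)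
  · have ht : 0 < t := lt_of_lt_of_le (by positivity) htr
    -- Both (c) and (d) follow from uniqueness: the claimed measure is checked to be a Riesz measure
    -- of the same potential.
    exact (hRiesz t ht).unique (HeatFlowZeros.isRieszMeasure_semicircle hr htr)
  · exact (hμ t ht).1.unique
      (HeatFlowZeros.IsRieszMeasure.map_rotation htφ (hRiesz _ (norm_pos_iff.2 ht)))
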